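/- Let $D\ge 1$, let $U\subseteq\mathbb R$ be a non-empty connected open set, $Z=\mathbb Z_{\ge 0}^D$ with standard basis $\xi_1,\dots,\xi_D$, $|S|=s_1+\dots+s_D$ for $S\in Z$, and $Z_D=\{S\in Z : s_D=0\}$. Let $$\hat{\mathcal A}=C^\infty(U)[[\,u^S\ (S\in Z,\ |S|>0),\ \theta^S\ (S\in Z)\,]]$$ be the algebra of formal power series in commuting variables $u^S$ and anticommuting variables $\theta^S$, whose coefficients are smooth functions of $u=u^0\in U$. Let $\hat{\mathcal A}^p_d$ be the component of super degree $p$ (the number of $\theta$'s) and standard degree $d$, where $\deg u^S=\deg\theta^S=|S|$. Let $$\Delta=\sum_{S\in Z}\theta^{S+\xi_D}\frac{\partial}{\partial u^S}$$ be the operator on $\hat{\mathcal A}$ associated with the Poisson bracket $\{u(x),u(y)\}=\partial_{x^D}\delta(x-y)$, where $\partial/\partial u^0$ differentiates the coefficient functions. Let $\Theta=\mathbb R[\theta^S : S\in Z_D]$ be the real Grassmann algebra on the $\theta^S$ with $S\in Z_D$, and let $\Theta^p_d$ be the span of the monomials $\theta^{S_1}\cdots\theta^{S_p}$ with $S_i\in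 Z_D$ and $|S_1|+\dots+|S_p|=d$. Then $\Delta^2=0$ and $\Delta(\hat{\mathcal A}^p_d)\subseteq\hat{\mathcal A}^{p+1}_{d+1}$, and the following holds. (i) For all $p,d\ge 0$ the inclusion $\Theta\to\hat{\mathcal A}$ induces an isomorphism of vector spaces from $\Theta^p_d$ onto $$H^p_d(\hat{\mathcal A})=\frac{\ker(\Delta:\hat{\mathcal A}^p_d\to\hat{\mathcal A}^{p+1}_{d+1})}{\operatorname{im}(\Delta:\hat{\mathcal A}^{p-1}_{d-1}\to\hat{\mathcal A}^p_d)},$$ where $\hat{\mathcal A}^{p-1}_{d-1}=0$ if $p=0$ or $d=0$. (ii) Consequently, the inclusion induces an isomorphism of algebras from $\Theta$ onto $\bigoplus_{p,d}H^p_d(\hat{\mathcal A})$, the cohomology of $\bigoplus_{p,d}\hat{\mathcal A}^p_d$ with respect to $\Delta$; the product of two cocycles is a cocycle, and the product of classes is induced by that of $\hat{\mathcal A}$. (iii) Likewise, for the whole space of formal power series, the inclusion induces an isomorphism of algebras from $\hat\Theta$ onto $\ker\Delta/\Delta(\hat{\mathcal A})$, where $\hat\Theta\subset\hat{\mathcal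 A}$ is the completion of $\Theta$, i.e. the algebra of formal (possibly infinite) sums of monomials in the $\theta^S$, $S\in Z_D$, with real coefficients. -/

import Mathlib

open scoped Manifold ContDiff

noncomputable section

namespace ScalarPoisson

/-- Multi-indices `S ∈ ℤ_{≥0}^D`, where `D = n + 1 ≥ 1`. -/
abbrev MultiIndex (n : ℕ) : Type := Fin (n + 1) → ℕ

/-- The length `|S| = s₁ + ⋯ + s_D`. -/
def len {n : ℕ} (S : MultiIndex n) : ℕ := ∑ i, S i

/-- The last basis vector `ξ_D`. -/
def xiD (n : ℕ) : MultiIndex n := Pi.single (Fin.last n) 1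

/-! ### Formal series in anticommuting variables -/

/-- The sign produced by merging two strictly increasing products `θ^A θ^B` into an increasing
one: one factor `-1` for every pair `(a, b) ∈ A × B` with `b < a` lexicographically. -/
def mergeSign {n : ℕ} (A B : Finset (MultiIndex n)) : ℤ :=
  open Classical in
  ∏ a ∈ A, ∏ b ∈ B, if Pi.Lex (· < ·) (· < ·) b a then -1 else 1

/-- Formal series `∑_A f_A θ^A` in anticommuting variables `θ^S`, `S ∈ ℤ_{≥0}^D`, with
coefficients in `B`. Here `A` runs over the finite sets of multi-indices and `θ^A` is the product
of the `θ^S`, `S ∈ A`, in increasing lexicographic order. -/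
@[ext] structure GrassmannSeries (n : ℕ) (B : Type*) where
  /-- The coefficient of `θ^A`. -/
  coeff : Finset (MultiIndex n) → B

namespace GrassmannSeries

variable {n : ℕ} {B : Type*} [CommRing B]

instance : Zero (GrassmannSeries n B) := ⟨⟨fun _ => 0⟩⟩
instance : Add (GrassmannSeries n B) := ⟨fun f g => ⟨fun A => f.coeff A + g.coeff A⟩⟩
instance : Neg (GrassmannSeries n B) := ⟨fun f => ⟨fun A => -f.coeff A⟩⟩
instance [Algebra ℝ B] : SMul ℝ (GrassmannSeries n B) := ⟨fun r f => ⟨fun A => r • f.coeff A⟩⟩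

theorem ext' {n : ℕ} {B : Type*} {f g : GrassmannSeries n B} (h : ∀ A, f.coeff A = g.coeff A) : f = g :=
  GrassmannSeries.ext (funext h)

@[simp] theorem zero_coeff (A) : (0 : GrassmannSeries n B).coeff A = 0 := rfl
@[simp] theorem add_coeff (f g : GrassmannSeries n B) (A) :
    (f + g).coeff A = f.coeff A + g.coeff A := rfl
@[simp] theorem neg_coeff (f : GrassmannSeries n B) (A) : (-f).coeff A = -f.coeff A := rfl
@[simp] theorem smul_coeff [Algebra ℝ B] (r : ℝ) (f : GrassmannSeries n B) (A) :
    (r • f).coeff A = r • f.coeff A := rfl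

instance : AddCommGroup (GrassmannSeries n B) where
  add_assoc _ _ _ := ext' fun _ => add_assoc _ _ _
  zero_add _ := ext' fun _ => zero_add _
  add_zero _ := ext' fun _ => add_zero _
  add_comm _ _ := ext' fun _ => add_comm _ _
  neg_add_cancel _ := ext' fun _ => neg_add_cancel _
  nsmul := nsmulRec
  zsmul := zsmulRec

instance [Algebra ℝ B] : Module ℝ (GrassmannSeries n B) where
  one_smul _ := ext' fun _ => one_smul _ _
  mul_smul _ _ _ := ext' fun _ => mul_smul _ _ _
  smul_zero _ := ext' fun _ => smul_zero _
  smul_add _ _ _ := ext' fun _ => smul_add _ _ _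
  add_smul _ _ _ := ext' fun _ => add_smul _ _ _
  zero_smul _ := ext' fun _ => zero_smul _ _

/-- The product determined by `θ^A θ^B = ± θ^{A ∪ B}` for disjoint `A`, `B`, and
`θ^A θ^B = 0` otherwise. -/
instance : Mul (GrassmannSeries n B) where
  mul f g := ⟨fun A => ∑ C ∈ A.powerset, mergeSign C (A \ C) • (f.coeff C * g.coeff (A \ C))⟩

instance : One (GrassmannSeries n B) where
  one := ⟨fun A => if A = ∅ then 1 else 0⟩

theorem mul_coeff (f g : GrassmannSeries n B) (A) :
    (f * g).coeff A =
      ∑ C ∈ A.powerset, mergeSign C (A \ C) • (f.coeff C * g.coeff (A \ C)) := rfl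

theorem one_coeff (A) : (1 : GrassmannSeries n B).coeff A = if A = ∅ then 1 else 0 := rfl

theorem mergeSign_union_left {A A' C : Finset (MultiIndex n)} (h : Disjoint A A') :
    mergeSign (A ∪ A') C = mergeSign A C * mergeSign A' C := by
  simp [mergeSign, Finset.prod_union h]

theorem mergeSign_union_right {A C C' : Finset (MultiIndex n)} (h : Disjoint C C') :
    mergeSign A (C ∪ C') = mergeSign A C * mergeSign A C' := by
  simp [mergeSign, Finset.prod_union h, Finset.prod_mul_distrib]

theorem mul_assoc' (f g h : GrassmannSeries n B) : f * g * h = f * (g * h) := by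
  refine GrassmannSeries.ext' fun A => ?_
  simp only [mul_coeff, Finset.sum_mul, Finset.mul_sum, Finset.smul_sum, Finset.sum_sigma']
  refine Finset.sum_bij' (fun x _ => ⟨x.2, x.1 \ x.2⟩) (fun x _ => ⟨x.1 ∪ x.2, x.1⟩) ?_ ?_ ?_ ?_ ?_
  · rintro ⟨C, E⟩ hx
    simp only [Finset.mem_sigma, Finset.mem_powerset] at hx ⊢
    exact ⟨hx.2.trans hx.1, Finset.sdiff_subset_sdiff hx.1 le_rfl⟩
  · rintro ⟨C, E⟩ hx
    simp only [Finset.mem_sigma, Finset.mem_powerset] at hx ⊢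
    exact ⟨Finset.union_subset hx.1 (hx.2.trans Finset.sdiff_subset), Finset.subset_union_left⟩
  · rintro ⟨C, E⟩ hx
    simp only [Finset.mem_sigma, Finset.mem_powerset] at hx
    simp [Finset.union_sdiff_of_subset hx.2]
  · rintro ⟨C, E⟩ hx
    simp only [Finset.mem_sigma, Finset.mem_powerset] at hx
    have : (C ∪ E) \ C = E := by
      rw [Finset.union_sdiff_left, Finset.sdiff_eq_self_iff_disjoint]
      exact Finset.disjoint_of_subset_left hx.2 Finset.sdiff_disjoint
    simp [this]
  · rintro ⟨C, E⟩ hx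
    simp only [Finset.mem_sigma, Finset.mem_powerset] at hx
    obtain ⟨hC, hE⟩ := hx
    have e1 : (A \ E) \ (C \ E) = A \ C := by
      ext x; simp only [Finset.mem_sdiff]; have := @hE x; tauto
    have e2 : mergeSign C (A \ C) = mergeSign E (A \ C) * mergeSign (C \ E) (A \ C) := by
      rw [← mergeSign_union_left Finset.disjoint_sdiff, Finset.union_sdiff_of_subset hE]
    have e3 : mergeSign E (A \ E) = mergeSign E (C \ E) * mergeSign E (A \ C) := by
      rw [← mergeSign_union_right]
      · congr 1
        ext x; simp only [Finset.mem_sdiff, Finset.mem_union]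
        have := @hE x; have := @hC x; tauto
      · exact Finset.disjoint_of_subset_left Finset.sdiff_subset Finset.disjoint_sdiff
    simp only [e1, e2, e3, zsmul_eq_mul]
    push_cast
    ring

instance : Ring (GrassmannSeries n B) where
  __ := (inferInstance : AddCommGroup (GrassmannSeries n B))
  left_distrib f g h := by
    refine GrassmannSeries.ext' fun A => ?_; simp [mul_coeff, mul_add, Finset.sum_add_distrib]
  right_distrib f g h := by
    refine GrassmannSeries.ext' fun A => ?_; simp [mul_coeff, add_mul, Finset.sum_add_distrib]
  zero_mul f := by refine GrassmannSeries.ext' fun A => ?_; simp [mul_coeff]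
  mul_zero f := by refine GrassmannSeries.ext' fun A => ?_; simp [mul_coeff]
  mul_assoc := mul_assoc'
  one_mul f := by
    refine GrassmannSeries.ext' fun A => ?_
    rw [mul_coeff, Finset.sum_eq_single ∅] <;> simp +contextual [one_coeff, mergeSign]
  mul_one f := by
    refine GrassmannSeries.ext' fun A => ?_
    rw [mul_coeff, Finset.sum_eq_single A]
    · simp [one_coeff, mergeSign]
    · intro C hC hne
      have : ¬ A ⊆ C := fun h => hne (Finset.Subset.antisymm (Finset.mem_powerset.1 hC) h)
      simp [one_coeff, Finset.sdiff_eq_empty_iff_subset, this]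
    · simp

instance [Algebra ℝ B] : Algebra ℝ (GrassmannSeries n B) :=
  Algebra.ofModule
    (fun r f g => by
      refine GrassmannSeries.ext' fun A => ?_; simp only [mul_coeff, smul_coeff, smul_mul_assoc, Finset.smul_sum]
      exact Finset.sum_congr rfl fun C _ => smul_comm _ _ _)
    (fun r f g => by
      refine GrassmannSeries.ext' fun A => ?_; simp only [mul_coeff, smul_coeff, mul_smul_comm, Finset.smul_sum]
      exact Finset.sum_congr rfl fun C _ => smul_comm _ _ _)

/-- The generator `θ^S`. -/
def theta (S : MultiIndex n) : GrassmannSeries n B :=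
  ⟨fun A => if A = {S} then 1 else 0⟩

end GrassmannSeries

/-! ### The algebra `Â` -/

/-- The ring `C^∞(U)` of smooth real functions on the open set `U ⊆ ℝ`. -/
abbrev Smooth (U : TopologicalSpace.Opens ℝ) : Type := C^∞⟮𝓘(ℝ, ℝ), U; 𝓘(ℝ, ℝ), ℝ⟯

/-- The derivative `f ↦ f'` on `C^∞(U)`; `f` is extended by zero to evaluate `deriv`, which does
not affect the derivative at the points of the open set `U`. -/
def smoothDeriv (U : TopologicalSpace.Opens ℝ) : Smooth U →ₗ[ℝ] Smooth U :=
  have key (f : Smooth U) : ContDiffOn ℝ ∞ (Function.extend Subtype.val f 0) (U : Set ℝ) := by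
    intro x hx
    have h : ContMDiffAt 𝓘(ℝ, ℝ) 𝓘(ℝ, ℝ) ∞
        (fun y : U => Function.extend Subtype.val f 0 (y : ℝ)) ⟨x, hx⟩ := by
      simpa [Subtype.val_injective.extend_apply] using f.contMDiff ⟨x, hx⟩
    exact (contMDiffAt_subtype_iff.1 h).contDiffAt.contDiffWithinAt
  have diff (f : Smooth U) (x : U) :
      DifferentiableAt ℝ (Function.extend Subtype.val f 0) (x : ℝ) :=
    ((key f).differentiableOn (by simp)).differentiableAt (U.isOpen.mem_nhds x.2)
  { toFun := fun f => ⟨fun x => deriv (Function.extend Subtype.val f 0) (x : ℝ), fun x => by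
      have h : ContDiffOn ℝ ∞ (deriv (Function.extend Subtype.val f 0)) (U : Set ℝ) :=
        (key f).deriv_of_isOpen U.isOpen (by simp)
      exact contMDiffAt_subtype_iff.2 ((h.contDiffAt (U.isOpen.mem_nhds x.2)).contMDiffAt)⟩
    map_add' := fun f g => by
      ext x
      have h : Function.extend Subtype.val (f + g : Smooth U) 0 =
          Function.extend Subtype.val f 0 + Function.extend Subtype.val g 0 := by
        simpa using Function.extend_add (Subtype.val : U → ℝ) f g 0 0
      change deriv (Function.extend Subtype.val (f + g : Smooth U) 0) (x : ℝ) = _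
      rw [h, deriv_add (diff f x) (diff g x)]
      rfl
    map_smul' := fun r f => by
      ext x
      have h : Function.extend Subtype.val (r • f : Smooth U) 0 =
          r • Function.extend Subtype.val f 0 := by
        simpa using Function.extend_smul r (Subtype.val : U → ℝ) f 0
      change deriv (Function.extend Subtype.val (r • f : Smooth U) 0) (x : ℝ) = _
      rw [h, deriv_const_smul _ (diff f x)]
      rfl }

/-- The jet variables `u^S`, `|S| > 0`. -/
abbrev JetIndex (n : ℕ) : Type := {S : MultiIndex n // S ≠ 0}

/-- `A = C^∞(U)[[u^S : |S| > 0]]`. -/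
abbrev DiffSeries (n : ℕ) (U : TopologicalSpace.Opens ℝ) : Type :=
  MvPowerSeries (JetIndex n) (Smooth U)

/-- `Â = C^∞(U)[[u^S (|S| > 0), θ^S (|S| ≥ 0)]]`. -/
abbrev AHat (n : ℕ) (U : TopologicalSpace.Opens ℝ) : Type := GrassmannSeries n (DiffSeries n U)

variable {n : ℕ} {U : TopologicalSpace.Opens ℝ}

/-- `∂/∂u^S` on `A`: differentiation of the coefficient functions if `S = 0`, the formal partial
derivative otherwise. -/
def partialU (S : MultiIndex n) : DiffSeries n U →ₗ[ℝ] DiffSeries n U :=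
  open Classical in
  if h : S = 0 then
    { toFun := fun f m => smoothDeriv U (MvPowerSeries.coeff m f)
      map_add' := fun f g => by ext1 m; exact map_add (smoothDeriv U) _ _
      map_smul' := fun r f => by ext1 m; exact map_smul (smoothDeriv U) r _ }
  else
    { toFun := MvPowerSeries.pderiv (Smooth U) ⟨S, h⟩
      map_add' := map_add _
      map_smul' := fun r f => by
        ext1 m
        rw [MvPowerSeries.coeff_pderiv]
        change (r • MvPowerSeries.coeff _ f) * _ =
          r • MvPowerSeries.coeff m (MvPowerSeries.pderiv (Smooth U) ⟨S, h⟩ f)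
        rw [MvPowerSeries.coeff_pderiv, smul_mul_assoc] }

/-- `∂/∂u^S` on `Â`, with `∂θ^T/∂u^S = 0`. -/
def partialUHat (S : MultiIndex n) : AHat n U →ₗ[ℝ] AHat n U where
  toFun f := ⟨fun A => partialU S (f.coeff A)⟩
  map_add' f g := by refine GrassmannSeries.ext' fun A => ?_; exact map_add (partialU S) _ _
  map_smul' r f := by refine GrassmannSeries.ext' fun A => ?_; exact map_smul (partialU S) r _

/-- The finitely many `S` with `S + ξ_D ∈ A`. -/
def shiftPreimage (A : Finset (MultiIndex n)) : Finset (MultiIndex n) :=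
  A.preimage (fun S => S + xiD n) (add_left_injective (xiD n)).injOn

/-- `Δ = ∑_S θ^{S + ξ_D} ∂/∂u^S` on `Â`. The sum is taken coefficientwise: the coefficient of
`θ^A` in `θ^{S + ξ_D} ∂f/∂u^S` vanishes unless `S + ξ_D ∈ A`. -/
def Delta (n : ℕ) (U : TopologicalSpace.Opens ℝ) : AHat n U →ₗ[ℝ] AHat n U where
  toFun f := ⟨fun A => ∑ S ∈ shiftPreimage A,
    (GrassmannSeries.theta (S + xiD n) * partialUHat S f).coeff A⟩
  map_add' f g := by
    refine GrassmannSeries.ext' fun A => ?_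
    simp [mul_add, Finset.sum_add_distrib]
  map_smul' r f := by
    refine GrassmannSeries.ext' fun A => ?_
    simp [Finset.smul_sum]

/-- The sum defining `Δ` is locally finite: no coefficient is lost. -/
theorem theta_mul_coeff_of_notMem {B : Type*} [CommRing B] (T : MultiIndex n)
    (g : GrassmannSeries n B) (A : Finset (MultiIndex n)) (hT : T ∉ A) :
    (GrassmannSeries.theta T * g).coeff A = 0 := by
  rw [GrassmannSeries.mul_coeff]
  refine Finset.sum_eq_zero fun C hC => ?_
  have : C ≠ {T} := by rintro rfl; exact hT (by simpa using hC)
  simp [GrassmannSeries.theta, this]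

/-! ### Gradations -/

/-- `Â^p_d`: the elements of super degree `p` and standard degree `d`, where
`deg u^S = deg θ^S = |S|`. -/
def homog (n : ℕ) (U : TopologicalSpace.Opens ℝ) (p d : ℕ) : Submodule ℝ (AHat n U) where
  carrier := {f | ∀ (A : Finset (MultiIndex n)) (m : JetIndex n →₀ ℕ),
    MvPowerSeries.coeff m (f.coeff A) ≠ 0 →
      A.card = p ∧ (∑ S ∈ A, len S) + m.sum (fun S k => k * len S.1) = d}
  zero_mem' := by intro A m h; simp at h
  add_mem' {f g} hf hg := by
    intro A m h
    by_cases h1 : MvPowerSeries.coeff m (f.coeff A) = 0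
    · by_cases h2 : MvPowerSeries.coeff m (g.coeff A) = 0
      · simp [h1, h2] at h
      · exact hg A m h2
    · exact hf A m h1
  smul_mem' r f hf := by
    intro A m h
    refine hf A m fun h0 => h ?_
    change r • MvPowerSeries.coeff m (f.coeff A) = 0
    rw [h0, smul_zero]

/-- `⨁_{p,d} Â^p_d`: the finite sums of bihomogeneous elements (the differential polynomials). -/
def polyPart (n : ℕ) (U : TopologicalSpace.Opens ℝ) : Submodule ℝ (AHat n U) :=
  ⨆ (p : ℕ) (d : ℕ), homog n U p d

/-! ### Cohomology -/

/-- The `Δ`-closed elements of `V`. -/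
def cocycles (V : Submodule ℝ (AHat n U)) : Submodule ℝ (AHat n U) :=
  V ⊓ LinearMap.ker (Delta n U)

/-- The `Δ`-closed elements of `V` modulo the images under `Δ` of elements of `W`. -/
abbrev Cohomology (V W : Submodule ℝ (AHat n U)) : Type :=
  ↥(cocycles V) ⧸ (W.map (Delta n U)).submoduleOf (cocycles V)

/-- The class of a cocycle. -/
def cls {V W : Submodule ℝ (AHat n U)} (a : AHat n U) (ha : a ∈ cocycles V) : Cohomology V W :=
  Submodule.Quotient.mk ⟨a, ha⟩

/-- `Â^{p-1}_{d-1}`, which is zero if `p = 0` or `d = 0`. -/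
def homogPred (n : ℕ) (U : TopologicalSpace.Opens ℝ) : ℕ → ℕ → Submodule ℝ (AHat n U)
  | p + 1, d + 1 => homog n U p d
  | _, _ => ⊥

/-- `H^p_d(Â)`, the cohomology of `Â^{p-1}_{d-1} → Â^p_d → Â^{p+1}_{d+1}`. -/
abbrev bigradedH (n : ℕ) (U : TopologicalSpace.Opens ℝ) (p d : ℕ) : Type :=
  Cohomology (homog n U p d) (homogPred n U p d)

/-! ### The Grassmann algebra `Θ` -/

/-- `Z_D`: the multi-indices `S` with `S_D = 0`. -/
abbrev ZD (n : ℕ) : Type := {S : MultiIndex n // S (Fin.last n) = 0}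

/-- `Θ = ℝ[θ^S : S ∈ Z_D]`, the real Grassmann algebra on generators indexed by `Z_D`. -/
abbrev Theta (n : ℕ) : Type := ExteriorAlgebra ℝ (ZD n →₀ ℝ)

/-- `Θ^p_d`, spanned by the monomials `θ^{S₁} ⋯ θ^{S_p}` with `|S₁| + ⋯ + |S_p| = d`. -/
def thetaHomog (n p d : ℕ) : Submodule ℝ (Theta n) :=
  Submodule.span ℝ {t | ∃ S : Fin p → ZD n, (∑ i, len (S i).1) = d ∧
    t = ExteriorAlgebra.ιMulti ℝ p (fun i => Finsupp.single (S i) (1 : ℝ))}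

/-- The linear combinations of the `θ^S`, `S ∈ Z_D`, as elements of `Â`. -/
def thetaLin (n : ℕ) (U : TopologicalSpace.Opens ℝ) : (ZD n →₀ ℝ) →ₗ[ℝ] AHat n U :=
  Finsupp.linearCombination ℝ fun S : ZD n => (GrassmannSeries.theta S.1 : AHat n U)

theorem theta_mul_theta_self {B : Type*} [CommRing B] (S : MultiIndex n) :
    (GrassmannSeries.theta S * GrassmannSeries.theta S : GrassmannSeries n B) = 0 := by
  refine GrassmannSeries.ext' fun A => ?_
  rw [GrassmannSeries.mul_coeff]
  refine Finset.sum_eq_zero fun C _ => ?_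
  by_cases h : C = {S}
  · have : A \ C ≠ {S} := by
      intro h'
      have hS : S ∈ A \ C := by simp [h']
      simp [h] at hS
    simp [GrassmannSeries.theta, this]
  · simp [GrassmannSeries.theta, h]

theorem theta_mul_theta_anticomm {B : Type*} [CommRing B] (S T : MultiIndex n) (hST : S ≠ T) :
    (GrassmannSeries.theta S * GrassmannSeries.theta T +
      GrassmannSeries.theta T * GrassmannSeries.theta S : GrassmannSeries n B) = 0 := by
  have hsgn : mergeSign {S} {T} + mergeSign {T} {S} = 0 := by
    have h : ∀ S T : MultiIndex n, toLex S < toLex T →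
        Pi.Lex (· < ·) (· < ·) S T ∧ ¬ Pi.Lex (· < ·) (· < ·) T S :=
      fun S T h => ⟨h, fun h' => lt_asymm h (show toLex T < toLex S from h')⟩
    have : toLex S ≠ toLex T := fun h => hST (toLex.injective h)
    rcases lt_or_gt_of_ne this with h' | h'
    · simp only [mergeSign, Finset.prod_singleton, if_pos (h S T h').1, if_neg (h S T h').2]; rfl
    · simp only [mergeSign, Finset.prod_singleton, if_pos (h T S h').1, if_neg (h T S h').2]; rfl
  have key : ∀ S T : MultiIndex n, S ≠ T → ∀ A,
      (GrassmannSeries.theta S * GrassmannSeries.theta T : GrassmannSeries n B).coeff A =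
        if A = {S, T} then (mergeSign {S} {T} : B) else 0 := by
    intro S T hST A
    rw [GrassmannSeries.mul_coeff]
    by_cases hS : S ∈ A
    · rw [Finset.sum_eq_single {S}]
      · have : A \ {S} = {T} ↔ A = {S, T} := by
          constructor
          · intro h
            rw [← Finset.insert_erase hS, Finset.erase_eq, h]
          · rintro rfl
            ext x; simp only [Finset.mem_sdiff, Finset.mem_insert, Finset.mem_singleton]
            constructor
            · tauto
            · rintro rfl; exact ⟨Or.inr rfl, hST.symm⟩
        by_cases hA : A = {S, T}
        · simp [GrassmannSeries.theta, hA]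
          simp [← hA, this.2 hA]
        · simp [GrassmannSeries.theta, mt this.1 hA, hA]
      · intro C _ hC; simp [GrassmannSeries.theta, hC]
      · simp [hS]
    · have hA : A ≠ {S, T} := by rintro rfl; simp at hS
      rw [if_neg hA]
      refine Finset.sum_eq_zero fun C hC => ?_
      have : C ≠ {S} := by rintro rfl; exact hS (by simpa using hC)
      simp [GrassmannSeries.theta, this]
  refine GrassmannSeries.ext' fun A => ?_
  rw [GrassmannSeries.add_coeff, key S T hST, key T S hST.symm, Finset.pair_comm T S]
  by_cases hA : A = {S, T}
  · simp only [hA, if_true, GrassmannSeries.zero_coeff]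
    exact_mod_cast congrArg (Int.cast : ℤ → B) hsgn
  · simp [hA]

theorem thetaLin_sq (v : ZD n →₀ ℝ) : thetaLin n U v * thetaLin n U v = 0 := by
  induction v using Finsupp.induction_linear with
  | zero => simp
  | add v w hv hw =>
    have cross : ∀ v w : ZD n →₀ ℝ,
        thetaLin n U v * thetaLin n U w + thetaLin n U w * thetaLin n U v = 0 := by
      intro v w
      induction v using Finsupp.induction_linear with
      | zero => simp
      | add v v' h h' =>
        rw [map_add, add_mul, mul_add, add_add_add_comm, h, h', add_zero]
      | single S r =>
        induction w using Finsupp.induction_linear with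
        | zero => simp
        | add w w' h h' =>
          rw [map_add, mul_add, add_mul, add_add_add_comm, h, h', add_zero]
        | single T s =>
          simp only [thetaLin, Finsupp.linearCombination_single, smul_mul_smul_comm, mul_comm s r,
            ← smul_add]
          by_cases hST : S = T
          · subst hST; simp [theta_mul_theta_self]
          · rw [theta_mul_theta_anticomm _ _ (fun h => hST (Subtype.ext h)), smul_zero]
    rw [map_add, add_mul, mul_add, mul_add, hv, hw, zero_add, add_zero, cross]
  | single S r =>
    simp [thetaLin, Finsupp.linearCombination_single, theta_mul_theta_self]

/-- The natural homomorphism of algebras `Θ → Â`, `θ^S ↦ θ^S`. -/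
def thetaIncl (n : ℕ) (U : TopologicalSpace.Opens ℝ) : Theta n →ₐ[ℝ] AHat n U :=
  ExteriorAlgebra.lift ℝ ⟨thetaLin n U, thetaLin_sq⟩

/-- The completion of `Θ` inside `Â`: the formal series `∑_A c_A θ^A` with constant coefficients
`c_A ∈ ℝ`, where `A` runs over the finite subsets of `Z_D`. -/
def thetaCompleted (n : ℕ) (U : TopologicalSpace.Opens ℝ) : Subalgebra ℝ (AHat n U) where
  carrier := {f | ∃ c : Finset (MultiIndex n) → ℝ,
    (∀ A, c A ≠ 0 → ∀ S ∈ A, S (Fin.last n) = 0) ∧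
    ∀ A, f.coeff A = algebraMap ℝ (DiffSeries n U) (c A)}
  mul_mem' := by
    rintro f g ⟨c, hc, hf⟩ ⟨e, he, hg⟩
    refine ⟨fun A => ∑ C ∈ A.powerset, mergeSign C (A \ C) • (c C * e (A \ C)), ?_, ?_⟩
    · intro A hA S hS
      obtain ⟨C, hC, h⟩ := Finset.exists_ne_zero_of_sum_ne_zero hA
      have h1 : c C ≠ 0 := by rintro h0; simp [h0] at h
      have h2 : e (A \ C) ≠ 0 := by rintro h0; simp [h0] at h
      by_cases hSC : S ∈ C
      · exact hc C h1 S hSC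
      · exact he _ h2 S (Finset.mem_sdiff.2 ⟨hS, hSC⟩)
    · intro A
      simp only [GrassmannSeries.mul_coeff, hf, hg, map_sum, map_zsmul, map_mul]
  add_mem' := by
    rintro f g ⟨c, hc, hf⟩ ⟨e, he, hg⟩
    refine ⟨c + e, ?_, ?_⟩
    · intro A hA S hS
      by_cases h : c A = 0
      · exact he A (by simpa [h] using hA) S hS
      · exact hc A h S hS
    · intro A; simp [hf, hg]
  algebraMap_mem' := by
    intro r
    refine ⟨fun A => if A = ∅ then r else 0, ?_, ?_⟩
    · intro A hA S hS
      have : A = ∅ := by by_contra h; simp [h] at hA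
      simp [this] at hS
    · intro A
      rw [Algebra.algebraMap_eq_smul_one, GrassmannSeries.smul_coeff, GrassmannSeries.one_coeff]
      by_cases h : A = ∅ <;> simp [h, Algebra.algebraMap_eq_smul_one]

end ScalarPoisson

end

noncomputable section

namespace ScalarPoisson

namespace GrassmannSeries

/-! ### Multiplication and contraction by a generator -/

section Contraction

variable {n : ℕ} {B : Type*} [CommRing B]

/-! Write `du^S` for `θ^{S+ξ_D}`. Then `Δ = ∑ du^S ∂/∂u^S` is the de Rham differential in the
variables `u^S`, and the `θ^S` with `S ∈ Z_D` are inert exterior generators. The theorem is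
therefore a Poincaré lemma, smooth in `u` and formal in the jets, with coefficients in the Grassmann
algebra on the inert generators.

The contracting homotopy has two pieces. For the jets, contraction with the Euler field, `∑_{T≠0}
u^T ∂/∂θ^{T+ξ_D}`, has as anticommutator with `Δ` the operator multiplying `u^m θ^A` by its weight,
the number of factors `u^T` and `θ^{T+ξ_D}` with `T ≠ 0` (`Delta_eulerHomotopy_add`). Since `Δ`
preserves the weight, one may divide by it wherever it is positive. What remains in weight zero is
the de Rham complex of the interval `U` with inert coefficients, which is contracted onto constants
by the antiderivative vanishing at a base point `x₀` (`Delta_contrIntegral_add`). Both pieces are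
cases of one computation, `Delta_contr_add_contr_Delta`.

Hence every closed `f` equals `specialize x₀ f + Δ (homotopy I f)`
(`eq_specialize_add_Delta_homotopy`). The specialization kills the image of `Δ`, fixes the constant
series in the inert generators and is multiplicative, so it inverts the map from `Θ` (or its
completion) to cohomology and respects products. The three versions differ only in where
specialization and homotopy land: both respect the bigrading, and in a fixed bidegree only finitely
many `θ^A` occur, so the specialization of a homogeneous element lies in `Θ` itself.

There are infinitely many variables, so operator identities are proved one coefficient at a time,
where a finite set of indices suffices. -/

theorem mergeSign_mul_self (A C : Finset (MultiIndex n)) :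
    mergeSign A C * mergeSign A C = 1 := by
  simp only [mergeSign, ← Finset.prod_mul_distrib]
  refine Finset.prod_eq_one fun a _ => Finset.prod_eq_one fun b _ => ?_
  split_ifs <;> simp

theorem mergeSign_singleton_comm {S T : MultiIndex n} (h : S ≠ T) :
    mergeSign {S} {T} = -mergeSign {T} {S} := by
  have hlt : ∀ S T : MultiIndex n, toLex S < toLex T →
      Pi.Lex (· < ·) (· < ·) S T ∧ ¬ Pi.Lex (· < ·) (· < ·) T S :=
    fun S T h => ⟨h, fun h' => lt_asymm h (show toLex T < toLex S from h')⟩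
  have hne : toLex S ≠ toLex T := fun h' => h (toLex.injective h')
  rcases lt_or_gt_of_ne hne with h' | h'
  · simp [mergeSign, if_pos (hlt S T h').1, if_neg (hlt S T h').2]
  · simp [mergeSign, if_pos (hlt T S h').1, if_neg (hlt T S h').2]

theorem mergeSign_insert_right {S T : MultiIndex n} {A : Finset (MultiIndex n)} (h : T ∉ A) :
    mergeSign {S} (insert T A) = mergeSign {S} {T} * mergeSign {S} A := by
  rw [Finset.insert_eq, mergeSign_union_right (Finset.disjoint_singleton_left.2 h)]

theorem theta_mul_coeff (T : MultiIndex n) (f : GrassmannSeries n B) (A : Finset (MultiIndex n)) :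
    (theta T * f).coeff A =
      if T ∈ A then mergeSign {T} (A.erase T) • f.coeff (A.erase T) else 0 := by
  split_ifs with h
  · rw [mul_coeff, Finset.sum_eq_single {T}]
    · simp [theta, Finset.sdiff_singleton_eq_erase]
    · intro C _ hC
      simp [theta, hC]
    · intro hT
      exact absurd (Finset.mem_powerset.2 (Finset.singleton_subset_iff.2 h)) hT
  · exact theta_mul_coeff_of_notMem T f A h

@[simp] theorem sum_coeff {ι : Type*} (s : Finset ι) (f : ι → GrassmannSeries n B)
    (A : Finset (MultiIndex n)) : (∑ i ∈ s, f i).coeff A = ∑ i ∈ s, (f i).coeff A := by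
  classical
  induction s using Finset.induction_on with
  | empty => simp
  | insert i s hi ih => simp [Finset.sum_insert hi, ih]

/-- The parity involution `f ↦ (-1)^{p} f` in super degree `p`. -/
def parity (f : GrassmannSeries n B) : GrassmannSeries n B :=
  ⟨fun A => (-1 : ℤ) ^ A.card • f.coeff A⟩

@[simp] theorem parity_coeff (f : GrassmannSeries n B) (A : Finset (MultiIndex n)) :
    (parity f).coeff A = (-1 : ℤ) ^ A.card • f.coeff A := rfl

/-- Each factor of `θ^A` that `θ^T` passes contributes one sign. -/
theorem mergeSign_singleton_right_comm {T : MultiIndex n} {A : Finset (MultiIndex n)} (h : T ∉ A) :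
    mergeSign A {T} = (-1) ^ A.card * mergeSign {T} A := by
  induction A using Finset.induction_on with
  | empty => simp [mergeSign]
  | insert S A hS ih =>
    rw [Finset.mem_insert, not_or] at h
    rw [mergeSign_insert_right hS, Finset.card_insert_of_notMem hS, Finset.insert_eq,
      mergeSign_union_left (Finset.disjoint_singleton_left.2 hS), ih h.2,
      mergeSign_singleton_comm (Ne.symm h.1)]
    ring

theorem mul_theta_coeff (T : MultiIndex n) (f : GrassmannSeries n B) (A : Finset (MultiIndex n)) :
    (f * theta T).coeff A =
      if T ∈ A then mergeSign (A.erase T) {T} • f.coeff (A.erase T) else 0 := by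
  have key : ∀ C ∈ A.powerset, A \ C = {T} → T ∈ A ∧ C = A.erase T := by
    intro C hC h
    have hT : T ∈ A \ C := by simp [h]
    refine ⟨(Finset.mem_sdiff.1 hT).1, ?_⟩
    rw [Finset.erase_eq, ← h, Finset.sdiff_sdiff_eq_self (Finset.mem_powerset.1 hC)]
  split_ifs with h
  · have hT : A \ A.erase T = {T} := by
      rw [Finset.erase_eq, Finset.sdiff_sdiff_eq_self (Finset.singleton_subset_iff.2 h)]
    rw [mul_coeff, Finset.sum_eq_single (A.erase T)]
    · simp [theta, hT]
    · intro C hC hne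
      simp [theta, mt (fun h' => (key C hC h').2) hne]
    · intro h'
      exact absurd (Finset.mem_powerset.2 (Finset.erase_subset _ _)) h'
  · rw [mul_coeff]
    refine Finset.sum_eq_zero fun C hC => ?_
    simp [theta, mt (fun h' => (key C hC h').1) h]

/-- This commutation is the source of the sign in the Leibniz rule for `Δ`. -/
theorem parity_mul_theta (T : MultiIndex n) (f : GrassmannSeries n B) :
    parity f * theta T = theta T * f := by
  refine GrassmannSeries.ext' fun A => ?_
  rw [mul_theta_coeff, theta_mul_coeff, parity_coeff,
    mergeSign_singleton_right_comm (Finset.notMem_erase T A), smul_smul, mul_right_comm,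
    ← mul_pow]
  simp

/-- Products of series are determined coefficientwise on subsets. -/
theorem mul_coeff_congr {f f' g g' : GrassmannSeries n B} {A : Finset (MultiIndex n)}
    (hf : ∀ C ⊆ A, f.coeff C = f'.coeff C) (hg : ∀ C ⊆ A, g.coeff C = g'.coeff C) :
    (f * g).coeff A = (f' * g').coeff A := by
  rw [mul_coeff, mul_coeff]
  refine Finset.sum_congr rfl fun C hC => ?_
  rw [hf C (Finset.mem_powerset.1 hC), hg _ Finset.sdiff_subset]

variable [Algebra ℝ B]

/-- The contraction `∂/∂θ^T`. -/
def contr (T : MultiIndex n) : GrassmannSeries n B →ₗ[ℝ] GrassmannSeries n B where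
  toFun f := ⟨fun A => if T ∈ A then 0 else mergeSign {T} A • f.coeff (insert T A)⟩
  map_add' f g := by
    refine GrassmannSeries.ext' fun A => ?_
    by_cases h : T ∈ A <;> simp [h]
  map_smul' r f := by
    refine GrassmannSeries.ext' fun A => ?_
    by_cases h : T ∈ A <;> simp [h]

theorem contr_coeff (T : MultiIndex n) (f : GrassmannSeries n B) (A : Finset (MultiIndex n)) :
    (contr T f).coeff A = if T ∈ A then 0 else mergeSign {T} A • f.coeff (insert T A) := rfl

/-- This composite and the opposite one below are complementary projections. They are kept separate
because in the homotopy formula different coefficient operators act on the two pieces. -/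
theorem contr_theta_mul_self (T : MultiIndex n) (f : GrassmannSeries n B)
    (A : Finset (MultiIndex n)) :
    (contr T (theta T * f)).coeff A = if T ∈ A then 0 else f.coeff A := by
  rw [contr_coeff, theta_mul_coeff]
  by_cases h : T ∈ A
  · simp [h]
  · simp only [h, if_false, Finset.mem_insert_self, if_true, Finset.erase_insert h, smul_smul,
      mergeSign_mul_self, one_smul]

theorem theta_mul_contr_self (T : MultiIndex n) (f : GrassmannSeries n B)
    (A : Finset (MultiIndex n)) :
    (theta T * contr T f).coeff A = if T ∈ A then f.coeff A else 0 := by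
  rw [theta_mul_coeff, contr_coeff]
  by_cases h : T ∈ A
  · simp only [h, if_true, Finset.notMem_erase, if_false, Finset.insert_erase h, smul_smul,
      mergeSign_mul_self, one_smul]
  · simp [h]

theorem contr_theta_mul_of_ne {S T : MultiIndex n} (hST : S ≠ T) (f : GrassmannSeries n B) :
    contr T (theta S * f) = -(theta S * contr T f) := by
  refine GrassmannSeries.ext' fun A => ?_
  rw [neg_coeff, contr_coeff, theta_mul_coeff, theta_mul_coeff, contr_coeff]
  by_cases hT : T ∈ A
  · simp [hT, Finset.mem_erase, hST.symm]
  by_cases hS : S ∈ A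
  · have hT' : T ∉ A.erase S := fun h => hT (Finset.mem_of_mem_erase h)
    have hA : mergeSign {T} A = mergeSign {T} {S} * mergeSign {T} (A.erase S) := by
      rw [← mergeSign_insert_right (Finset.notMem_erase S A), Finset.insert_erase hS]
    simp only [hT, hS, hT', if_false, if_true, Finset.mem_insert_of_mem hS,
      Finset.erase_insert_of_ne hST.symm, hA, mergeSign_insert_right hT',
      mergeSign_singleton_comm hST, smul_smul, ← neg_smul]
    congr 1
    -- Both orders of `S` and `T` have been reduced to `mergeSign {T} {S}`, whose square is 1.
    linear_combination
      (-mergeSign {T} (A.erase S) * mergeSign {S} (A.erase S)) * mergeSign_mul_self {T} {S}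
  · simp [hT, hS, hST]

/-- A linear map of the coefficient ring, applied to all coefficients. -/
def mapCoeff (X : B →ₗ[ℝ] B) : GrassmannSeries n B →ₗ[ℝ] GrassmannSeries n B where
  toFun f := ⟨fun A => X (f.coeff A)⟩
  map_add' f g := by refine GrassmannSeries.ext' fun A => ?_; simp
  map_smul' r f := by refine GrassmannSeries.ext' fun A => ?_; simp

@[simp] theorem mapCoeff_coeff (X : B →ₗ[ℝ] B) (f : GrassmannSeries n B)
    (A : Finset (MultiIndex n)) : (mapCoeff X f).coeff A = X (f.coeff A) := rfl

theorem mapCoeff_theta_mul (X : B →ₗ[ℝ] B) (T : MultiIndex n) (f : GrassmannSeries n B) :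
    mapCoeff X (theta T * f) = theta T * mapCoeff X f := by
  refine GrassmannSeries.ext' fun A => ?_
  rw [mapCoeff_coeff, theta_mul_coeff, theta_mul_coeff]
  split_ifs
  · exact map_zsmul X _ _
  · exact map_zero X

theorem mapCoeff_contr (X : B →ₗ[ℝ] B) (T : MultiIndex n) (f : GrassmannSeries n B) :
    mapCoeff X (contr T f) = contr T (mapCoeff X f) := by
  refine GrassmannSeries.ext' fun A => ?_
  rw [mapCoeff_coeff, contr_coeff, contr_coeff]
  split_ifs
  · exact map_zero X
  · exact map_zsmul X _ _

theorem mapCoeff_mul (X : B →ₗ[ℝ] B) (hX : ∀ a b, X (a * b) = X a * b + a * X b)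
    (f g : GrassmannSeries n B) :
    mapCoeff X (f * g) = mapCoeff X f * g + f * mapCoeff X g := by
  refine GrassmannSeries.ext' fun A => ?_
  simp only [mapCoeff_coeff, mul_coeff, map_sum, map_zsmul, hX, add_coeff, smul_add,
    Finset.sum_add_distrib]

end Contraction

end GrassmannSeries

/-! ### Smooth functions on an interval -/

section Smooth

variable {U : TopologicalSpace.Opens ℝ}

theorem contDiffOn_extend (f : Smooth U) :
    ContDiffOn ℝ ∞ (Function.extend Subtype.val f 0) (U : Set ℝ) := by
  intro x hx
  have h : ContMDiffAt 𝓘(ℝ, ℝ) 𝓘(ℝ, ℝ) ∞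
      (fun y : U => Function.extend Subtype.val f 0 (y : ℝ)) ⟨x, hx⟩ := by
    simpa [Subtype.val_injective.extend_apply] using f.contMDiff ⟨x, hx⟩
  exact (contMDiffAt_subtype_iff.1 h).contDiffAt.contDiffWithinAt

theorem differentiableAt_extend (f : Smooth U) (x : U) :
    DifferentiableAt ℝ (Function.extend Subtype.val f 0) (x : ℝ) :=
  ((contDiffOn_extend f).differentiableOn (by simp)).differentiableAt (U.isOpen.mem_nhds x.2)

theorem smoothDeriv_apply (f : Smooth U) (x : U) :
    smoothDeriv U f x = deriv (Function.extend Subtype.val f 0) (x : ℝ) := rfl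

theorem extend_apply (f : Smooth U) (x : U) :
    Function.extend Subtype.val f (0 : ℝ → ℝ) (x : ℝ) = f x :=
  Subtype.val_injective.extend_apply _ _ _

theorem smoothDeriv_mul (f g : Smooth U) :
    smoothDeriv U (f * g) = smoothDeriv U f * g + f * smoothDeriv U g := by
  ext x
  have h : Function.extend Subtype.val (f * g : Smooth U) 0 =
      Function.extend Subtype.val f 0 * Function.extend Subtype.val g 0 := by
    simpa using Function.extend_mul (Subtype.val : U → ℝ) f g 0 0
  change deriv (Function.extend Subtype.val (f * g : Smooth U) 0) (x : ℝ) =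
    smoothDeriv U f x * g x + f x * smoothDeriv U g x
  rw [h, deriv_mul (differentiableAt_extend f x) (differentiableAt_extend g x),
    extend_apply, extend_apply, smoothDeriv_apply, smoothDeriv_apply]

theorem smoothDeriv_algebraMap (r : ℝ) : smoothDeriv U (algebraMap ℝ (Smooth U) r) = 0 := by
  -- A derivation kills 1, since `D 1 = D (1 * 1) = D 1 + D 1`.
  have h1 : smoothDeriv U 1 = 0 := by
    have h := smoothDeriv_mul (1 : Smooth U) 1
    simpa using h
  rw [Algebra.algebraMap_eq_smul_one, map_smul, h1, smul_zero]

theorem algebraMap_smooth_apply (r : ℝ) (x : U) : algebraMap ℝ (Smooth U) r x = r := rfl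

theorem eq_algebraMap_of_smoothDeriv_eq_zero (hU : IsPreconnected (U : Set ℝ)) (x₀ : U)
    {f : Smooth U} (hf : smoothDeriv U f = 0) : f = algebraMap ℝ (Smooth U) (f x₀) := by
  ext x
  have h := U.isOpen.is_const_of_deriv_eq_zero hU
    ((contDiffOn_extend f).differentiableOn (by simp))
    (fun y hy => by
      have := congrArg (fun g : Smooth U => g ⟨y, hy⟩) hf
      exact this) x.2 x₀.2
  rw [extend_apply, extend_apply] at h
  rw [h, algebraMap_smooth_apply]

/-- The primitive is the integral from `x₀`; it is smooth because its derivative is. -/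
theorem smoothDeriv_surjective (hU : IsPreconnected (U : Set ℝ)) (x₀ : U) :
    Function.Surjective (smoothDeriv U) := by
  intro f
  set F : ℝ → ℝ := Function.extend Subtype.val f 0 with hF
  have hcont : ContinuousOn F U := (contDiffOn_extend f).continuousOn
  have hder : ∀ x : U, HasDerivAt (fun y => ∫ t in (x₀ : ℝ)..y, F t) (F x) x := by
    intro x
    -- Connectedness keeps the whole interval of integration inside `U`.
    have hsub : Set.uIcc (x₀ : ℝ) x ⊆ U := hU.ordConnected.uIcc_subset x₀.2 x.2
    exact intervalIntegral.integral_hasDerivAt_right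
      (hcont.mono hsub).intervalIntegrable
      (hcont.stronglyMeasurableAtFilter U.isOpen x x.2)
      (hcont.continuousAt (U.isOpen.mem_nhds x.2))
  have hdiff : ContDiffOn ℝ ∞ (fun y => ∫ t in (x₀ : ℝ)..y, F t) U := by
    rw [contDiffOn_infty_iff_deriv_of_isOpen U.isOpen]
    refine ⟨fun x hx => (hder ⟨x, hx⟩).differentiableAt.differentiableWithinAt, ?_⟩
    exact (contDiffOn_extend f).congr fun x hx => (hder ⟨x, hx⟩).deriv
  have hsmooth : ContMDiff 𝓘(ℝ, ℝ) 𝓘(ℝ, ℝ) ∞ fun x : U => ∫ t in (x₀ : ℝ)..(x : ℝ), F t :=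
    fun x => contMDiffAt_subtype_iff.2 ((hdiff.contDiffAt (U.isOpen.mem_nhds x.2)).contMDiffAt)
  let G : Smooth U := ⟨_, hsmooth⟩
  refine ⟨G, ?_⟩
  ext x
  rw [smoothDeriv_apply, ← extend_apply f x]
  refine Eq.trans (Filter.EventuallyEq.deriv_eq ?_) (hder x).deriv
  filter_upwards [U.isOpen.mem_nhds x.2] with y hy
  exact extend_apply G ⟨y, hy⟩

/-- An antiderivative on an interval that is linear and vanishes at a base point. -/
theorem exists_antiderivative (hU : IsPreconnected (U : Set ℝ)) (x₀ : U) :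
    ∃ I : Smooth U →ₗ[ℝ] Smooth U, (∀ f, smoothDeriv U (I f) = f) ∧
      ∀ f, I (smoothDeriv U f) = f - algebraMap ℝ (Smooth U) (f x₀) := by
  obtain ⟨J, hJ⟩ := (smoothDeriv U).exists_rightInverse_of_surjective
    (LinearMap.range_eq_top.2 (smoothDeriv_surjective hU x₀))
  have hJ' : ∀ f, smoothDeriv U (J f) = f := fun f => LinearMap.congr_fun hJ f
  let ev : Smooth U →ₗ[ℝ] ℝ :=
    { toFun := fun f => f x₀, map_add' := fun _ _ => rfl, map_smul' := fun _ _ => rfl }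
  -- `J` is an arbitrary linear section of the derivative; subtracting its value at `x₀` makes the
  -- antiderivative vanish there.
  let I : Smooth U →ₗ[ℝ] Smooth U := J - (Algebra.linearMap ℝ (Smooth U)) ∘ₗ ev ∘ₗ J
  have hI : ∀ f, I f = J f - algebraMap ℝ (Smooth U) (J f x₀) := fun f => rfl
  refine ⟨I, fun f => ?_, fun f => ?_⟩
  · rw [hI, map_sub, hJ', smoothDeriv_algebraMap, sub_zero]
  · have h := eq_algebraMap_of_smoothDeriv_eq_zero hU x₀
      (f := I (smoothDeriv U f) - f) (by
        rw [hI, map_sub, map_sub, hJ', smoothDeriv_algebraMap, sub_zero, sub_self])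
    have h0 : (I (smoothDeriv U f) - f) x₀ = -f x₀ := by
      rw [hI]
      change J (smoothDeriv U f) x₀ - J (smoothDeriv U f) x₀ - f x₀ = _
      ring
    rw [h0, map_neg] at h
    rw [← sub_add_cancel (I (smoothDeriv U f)) f, h]
    ring

end Smooth

/-! ### The partial derivatives on `A` -/

section Partial

variable {n : ℕ} {U : TopologicalSpace.Opens ℝ}

theorem coeff_partialU_zero (f : DiffSeries n U) (m : JetIndex n →₀ ℕ) :
    MvPowerSeries.coeff m (partialU 0 f) = smoothDeriv U (MvPowerSeries.coeff m f) := by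
  simp only [partialU, dif_pos]
  rfl

theorem partialU_of_ne {S : MultiIndex n} (h : S ≠ 0) (f : DiffSeries n U) :
    partialU S f = MvPowerSeries.pderiv (Smooth U) ⟨S, h⟩ f := by
  simp only [partialU, dif_neg h]
  rfl

theorem coeff_partialU_of_ne {S : MultiIndex n} (h : S ≠ 0) (f : DiffSeries n U)
    (m : JetIndex n →₀ ℕ) :
    MvPowerSeries.coeff m (partialU S f) =
      ((m ⟨S, h⟩ : ℝ) + 1) • MvPowerSeries.coeff (m + Finsupp.single ⟨S, h⟩ 1) f := by
  rw [partialU_of_ne h, MvPowerSeries.coeff_pderiv, Algebra.smul_def, mul_comm]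
  simp

theorem partialU_mul (S : MultiIndex n) (f g : DiffSeries n U) :
    partialU S (f * g) = partialU S f * g + f * partialU S g := by
  classical
  by_cases h : S = 0
  · subst h
    ext1 m
    simp only [coeff_partialU_zero, map_add, MvPowerSeries.coeff_mul, map_sum, smoothDeriv_mul,
      Finset.sum_add_distrib]
  · simp only [partialU_of_ne h, Derivation.leibniz, smul_eq_mul]
    ring

theorem partialU_comm (S T : MultiIndex n) (f : DiffSeries n U) :
    partialU S (partialU T f) = partialU T (partialU S f) := by
  ext1 m
  by_cases hS : S = 0 <;> by_cases hT : T = 0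
  · rw [hS, hT]
  · subst hS
    simp only [coeff_partialU_zero, coeff_partialU_of_ne hT, map_smul]
  · subst hT
    simp only [coeff_partialU_zero, coeff_partialU_of_ne hS, map_smul]
  · by_cases hST : S = T
    · rw [hST]
    have h1 : (⟨S, hS⟩ : JetIndex n) ≠ ⟨T, hT⟩ := fun h => hST (congrArg Subtype.val h)
    simp only [coeff_partialU_of_ne hT, coeff_partialU_of_ne hS, smul_smul, Finsupp.add_apply,
      Finsupp.single_eq_of_ne h1, Finsupp.single_eq_of_ne h1.symm, add_zero]
    rw [mul_comm, add_right_comm]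

/-- Multiplication by a jet variable. -/
def mulX (T : JetIndex n) : DiffSeries n U →ₗ[ℝ] DiffSeries n U :=
  LinearMap.mulLeft ℝ (MvPowerSeries.X T)

theorem mulX_apply (T : JetIndex n) (f : DiffSeries n U) :
    mulX T f = MvPowerSeries.X T * f := rfl

theorem coeff_mulX (T : JetIndex n) (f : DiffSeries n U) (m : JetIndex n →₀ ℕ) :
    MvPowerSeries.coeff m (mulX T f) =
      if m T = 0 then 0 else MvPowerSeries.coeff (m - Finsupp.single T 1) f := by
  classical
  rw [mulX_apply, MvPowerSeries.X_def, MvPowerSeries.coeff_monomial_mul]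
  simp only [Finsupp.single_le_iff, one_mul]
  split_ifs <;> first | rfl | omega

theorem partialU_mulX_of_ne {S : MultiIndex n} {T : JetIndex n} (h : S ≠ T.1)
    (f : DiffSeries n U) : partialU S (mulX T f) = mulX T (partialU S f) := by
  by_cases hS : S = 0
  · subst hS
    ext1 m
    rw [coeff_partialU_zero, coeff_mulX, coeff_mulX, coeff_partialU_zero]
    split_ifs <;> simp
  · have hX : MvPowerSeries.pderiv (Smooth U) ⟨S, hS⟩ (MvPowerSeries.X T) = 0 :=
      MvPowerSeries.pderiv_X_of_ne fun h' => h (congrArg Subtype.val h').symm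
    rw [partialU_of_ne hS, partialU_of_ne hS, mulX_apply, mulX_apply, Derivation.leibniz, hX]
    simp

theorem partialU_mulX_self (T : JetIndex n) (f : DiffSeries n U) :
    partialU T.1 (mulX T f) = f + mulX T (partialU T.1 f) := by
  rw [partialU_of_ne T.2, partialU_of_ne T.2, mulX_apply, mulX_apply, Derivation.leibniz]
  change _ + f • MvPowerSeries.pderiv (Smooth U) T (MvPowerSeries.X T) = _
  rw [MvPowerSeries.pderiv_X_self, smul_eq_mul, smul_eq_mul, mul_one, add_comm]

/-- The Euler operator of the single variable `u^T` counts the factors `u^T`. -/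
theorem coeff_mulX_partialU (T : JetIndex n) (f : DiffSeries n U) (m : JetIndex n →₀ ℕ) :
    MvPowerSeries.coeff m (mulX T (partialU T.1 f)) = (m T : ℝ) • MvPowerSeries.coeff m f := by
  rw [coeff_mulX, coeff_partialU_of_ne T.2]
  split_ifs with h
  · simp [h]
  · have hle : Finsupp.single T 1 ≤ m := Finsupp.single_le_iff.2 (Nat.one_le_iff_ne_zero.2 h)
    change (((m - Finsupp.single T 1 : JetIndex n →₀ ℕ) T : ℝ) + 1) •
      MvPowerSeries.coeff (m - Finsupp.single T 1 + Finsupp.single T 1) f = _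
    rw [tsub_add_cancel_of_le hle, Finsupp.tsub_apply, Finsupp.single_eq_same,
      Nat.cast_sub (Nat.one_le_iff_ne_zero.2 h), Nat.cast_one, sub_add_cancel]

/-- A linear map of the coefficient functions, applied to all coefficients of a series. -/
def mapSmooth (I : Smooth U →ₗ[ℝ] Smooth U) : DiffSeries n U →ₗ[ℝ] DiffSeries n U where
  toFun f m := I (MvPowerSeries.coeff m f)
  map_add' f g := by ext1 m; exact map_add I _ _
  map_smul' r f := by ext1 m; exact map_smul I r _

theorem coeff_mapSmooth (I : Smooth U →ₗ[ℝ] Smooth U) (f : DiffSeries n U)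
    (m : JetIndex n →₀ ℕ) :
    MvPowerSeries.coeff m (mapSmooth I f) = I (MvPowerSeries.coeff m f) := rfl

theorem partialU_mapSmooth_of_ne {S : MultiIndex n} (h : S ≠ 0) (I : Smooth U →ₗ[ℝ] Smooth U)
    (f : DiffSeries n U) : partialU S (mapSmooth I f) = mapSmooth I (partialU S f) := by
  ext1 m
  simp only [coeff_partialU_of_ne h, coeff_mapSmooth, map_smul]

end Partial

open GrassmannSeries

/-! ### The operator `Δ` -/

section Delta

variable {n : ℕ} {U : TopologicalSpace.Opens ℝ}

theorem mem_shiftPreimage {A : Finset (MultiIndex n)} {S : MultiIndex n} :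
    S ∈ shiftPreimage A ↔ S + xiD n ∈ A := by
  simp [shiftPreimage]

theorem shiftPreimage_mono {A C : Finset (MultiIndex n)} (h : C ⊆ A) :
    shiftPreimage C ⊆ shiftPreimage A := fun _ hS =>
  mem_shiftPreimage.2 (h (mem_shiftPreimage.1 hS))

/-- The finite part `∑_{S ∈ F} θ^{S + ξ_D} ∂/∂u^S` of `Δ`. -/
def DeltaOn (F : Finset (MultiIndex n)) : AHat n U →ₗ[ℝ] AHat n U :=
  ∑ S ∈ F, LinearMap.mulLeft ℝ (theta (S + xiD n)) ∘ₗ mapCoeff (partialU S)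

theorem DeltaOn_apply (F : Finset (MultiIndex n)) (f : AHat n U) :
    DeltaOn F f = ∑ S ∈ F, theta (S + xiD n) * mapCoeff (partialU S) f := by
  simp [DeltaOn, LinearMap.sum_apply]

/-- A term with `S + ξ_D ∉ A` contributes nothing at `θ^A`, so any larger finite index set may be
used. This freedom lets coefficients at several sets be computed with one common `F`. -/
theorem Delta_coeff_eq_DeltaOn {F A : Finset (MultiIndex n)} (h : shiftPreimage A ⊆ F)
    (f : AHat n U) : (Delta n U f).coeff A = (DeltaOn F f).coeff A := by
  rw [DeltaOn_apply, sum_coeff]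
  change ∑ S ∈ shiftPreimage A, (theta (S + xiD n) * mapCoeff (partialU S) f).coeff A = _
  refine Finset.sum_subset h fun S _ hS => ?_
  exact theta_mul_coeff_of_notMem _ _ _ (mt mem_shiftPreimage.2 hS)

theorem coeff_Delta (f : AHat n U) (A : Finset (MultiIndex n)) (m : JetIndex n →₀ ℕ) :
    MvPowerSeries.coeff m ((Delta n U f).coeff A) =
      ∑ S ∈ shiftPreimage A, mergeSign {S + xiD n} (A.erase (S + xiD n)) •
        MvPowerSeries.coeff m (partialU S (f.coeff (A.erase (S + xiD n)))) := by
  change MvPowerSeries.coeff m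
    (∑ S ∈ shiftPreimage A, (theta (S + xiD n) * mapCoeff (partialU S) f).coeff A) = _
  rw [map_sum]
  refine Finset.sum_congr rfl fun S hS => ?_
  rw [theta_mul_coeff, if_pos (mem_shiftPreimage.1 hS), map_zsmul, mapCoeff_coeff]

theorem DeltaOn_coeff_congr (F : Finset (MultiIndex n)) {f g : AHat n U}
    {A : Finset (MultiIndex n)} (h : ∀ C ⊆ A, f.coeff C = g.coeff C) :
    (DeltaOn F f).coeff A = (DeltaOn F g).coeff A := by
  simp only [DeltaOn_apply, sum_coeff]
  refine Finset.sum_congr rfl fun S _ => mul_coeff_congr (fun _ _ => rfl) fun C hC => ?_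
  rw [mapCoeff_coeff, mapCoeff_coeff, h C hC]

theorem theta_mul_theta_comm (S T : MultiIndex n) :
    (theta S * theta T : AHat n U) = -(theta T * theta S) := by
  by_cases h : S = T
  · subst h
    simp [theta_mul_theta_self]
  · exact eq_neg_of_add_eq_zero_left (theta_mul_theta_anticomm S T h)

/-- The `θ`'s anticommute while the partial derivatives commute, so exchanging the two summation
indices shows that the double sum is its own negative. -/
theorem DeltaOn_DeltaOn (F : Finset (MultiIndex n)) (f : AHat n U) :
    DeltaOn F (DeltaOn F f) = 0 := by
  have h : DeltaOn F (DeltaOn F f) = ∑ S ∈ F, ∑ T ∈ F,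
      theta (S + xiD n) * theta (T + xiD n) *
        mapCoeff (partialU S) (mapCoeff (partialU T) f) := by
    simp only [DeltaOn_apply, map_sum, mapCoeff_theta_mul, mul_assoc]
    exact Finset.sum_comm
  have hneg : DeltaOn F (DeltaOn F f) = -DeltaOn F (DeltaOn F f) := by
    conv_lhs => rw [h, Finset.sum_comm]
    rw [h, ← Finset.sum_neg_distrib]
    refine Finset.sum_congr rfl fun S _ => ?_
    rw [← Finset.sum_neg_distrib]
    refine Finset.sum_congr rfl fun T _ => ?_
    rw [theta_mul_theta_comm, neg_mul]
    congr 2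
    refine GrassmannSeries.ext' fun A => ?_
    exact partialU_comm _ _ _
  have h2 : (2 : ℝ) • DeltaOn F (DeltaOn F f) = 0 := by
    rw [two_smul, ← eq_neg_iff_add_eq_zero]
    exact hneg
  exact (smul_eq_zero.1 h2).resolve_left two_ne_zero

theorem Delta_Delta (f : AHat n U) : Delta n U (Delta n U f) = 0 := by
  refine GrassmannSeries.ext' fun A => ?_
  rw [Delta_coeff_eq_DeltaOn (le_refl (shiftPreimage A)), DeltaOn_coeff_congr _
    (fun C hC => Delta_coeff_eq_DeltaOn (shiftPreimage_mono hC) f), DeltaOn_DeltaOn]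

theorem DeltaOn_mul (F : Finset (MultiIndex n)) (f g : AHat n U) :
    DeltaOn F (f * g) = DeltaOn F f * g + parity f * DeltaOn F g := by
  simp only [DeltaOn_apply, Finset.sum_mul, Finset.mul_sum, ← Finset.sum_add_distrib]
  refine Finset.sum_congr rfl fun S _ => ?_
  rw [mapCoeff_mul _ (partialU_mul S), mul_add, ← mul_assoc, ← mul_assoc, ← mul_assoc,
    parity_mul_theta]

/-- `Δ` is an antiderivation. -/
theorem Delta_mul (f g : AHat n U) :
    Delta n U (f * g) = Delta n U f * g + parity f * Delta n U g := by
  refine GrassmannSeries.ext' fun A => ?_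
  rw [Delta_coeff_eq_DeltaOn (le_refl (shiftPreimage A)), DeltaOn_mul, add_coeff, add_coeff]
  congr 1
  · exact mul_coeff_congr
      (fun C hC => (Delta_coeff_eq_DeltaOn (shiftPreimage_mono hC) f).symm) fun _ _ => rfl
  · exact mul_coeff_congr (fun _ _ => rfl)
      fun C hC => (Delta_coeff_eq_DeltaOn (shiftPreimage_mono hC) g).symm

/-- The anticommutator of `Δ` with the contraction by `θ^{T + ξ_D}`, followed by an operator on
the coefficients that commutes with the derivatives in all other directions. -/
theorem Delta_contr_add_contr_Delta (T : MultiIndex n) (X : DiffSeries n U →ₗ[ℝ] DiffSeries n U)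
    (hX : ∀ S, S ≠ T → ∀ f, partialU S (X f) = X (partialU S f)) (f : AHat n U)
    (A : Finset (MultiIndex n)) :
    (Delta n U (contr (T + xiD n) (mapCoeff X f)) +
        contr (T + xiD n) (mapCoeff X (Delta n U f))).coeff A =
      if T + xiD n ∈ A then partialU T (X (f.coeff A)) else X (partialU T (f.coeff A)) := by
  classical
  -- Contraction at `A` reads the coefficient at `insert (T + xiD n) A`, so `T` must be added to the
  -- indices relevant for `A`.
  set F := insert T (shiftPreimage A) with hF
  have hsub : shiftPreimage A ⊆ F := Finset.subset_insert _ _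
  have hsub' : shiftPreimage (insert (T + xiD n) A) ⊆ F := by
    intro S hS
    rw [mem_shiftPreimage, Finset.mem_insert] at hS
    rw [hF, Finset.mem_insert, mem_shiftPreimage]
    exact hS.imp_left add_right_cancel
  have h2 : (contr (T + xiD n) (mapCoeff X (Delta n U f))).coeff A =
      (contr (T + xiD n) (mapCoeff X (DeltaOn F f))).coeff A := by
    rw [contr_coeff, contr_coeff, mapCoeff_coeff, mapCoeff_coeff, Delta_coeff_eq_DeltaOn hsub']
  rw [add_coeff, Delta_coeff_eq_DeltaOn hsub, h2, DeltaOn_apply, DeltaOn_apply, map_sum, map_sum,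
    ← add_coeff, ← Finset.sum_add_distrib, sum_coeff, Finset.sum_eq_single T]
  -- For `S = T` the two orders of composition live on the complementary cases `T + ξ_D ∈ A` and `T
  -- + ξ_D ∉ A`.
  · rw [add_coeff, mapCoeff_contr, theta_mul_contr_self, mapCoeff_theta_mul,
      contr_theta_mul_self]
    split_ifs <;> simp
  -- For `S ≠ T` the coefficient operators commute and the contraction anticommutes with
  -- `θ^{S+ξ_D}`, so the two terms cancel.
  · intro S _ hST
    have hne : S + xiD n ≠ T + xiD n := fun h => hST (add_right_cancel h)
    have hcomm : mapCoeff (partialU S) (mapCoeff X f) = mapCoeff X (mapCoeff (partialU S) f) :=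
      GrassmannSeries.ext' fun A => hX S hST _
    rw [mapCoeff_contr, mapCoeff_theta_mul, contr_theta_mul_of_ne hne, hcomm, add_neg_cancel,
      zero_coeff]
  · intro hT
    exact absurd (Finset.mem_insert_self _ _) hT

end Delta

/-! ### The contracting homotopy -/

section Homotopy

variable {n : ℕ} {U : TopologicalSpace.Opens ℝ}

theorem ext_coeff {f g : AHat n U} (h : ∀ A (m : JetIndex n →₀ ℕ),
    MvPowerSeries.coeff m (f.coeff A) = MvPowerSeries.coeff m (g.coeff A)) : f = g :=
  GrassmannSeries.ext' fun A => MvPowerSeries.ext (h A)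

/-- The finitely many `T ≠ 0` with `T + ξ_D ∈ A`. -/
def jetShiftPreimage (A : Finset (MultiIndex n)) : Finset (JetIndex n) :=
  (shiftPreimage A).subtype (· ≠ 0)

theorem mem_jetShiftPreimage {A : Finset (MultiIndex n)} {T : JetIndex n} :
    T ∈ jetShiftPreimage A ↔ T.1 + xiD n ∈ A := by
  simp [jetShiftPreimage, mem_shiftPreimage]

/-- The number of factors `u^T` and `θ^{T + ξ_D}`, `T ≠ 0`, in the monomial `u^m θ^A`. -/
def weight (A : Finset (MultiIndex n)) (m : JetIndex n →₀ ℕ) : ℕ :=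
  m.degree + (jetShiftPreimage A).card

/-- The operator that contracts by `θ^{T + ξ_D}` and multiplies by `u^T`. -/
def contrMulX (T : JetIndex n) (f : AHat n U) : AHat n U :=
  contr (T.1 + xiD n) (mapCoeff (mulX T) f)

theorem coeff_contrMulX (T : JetIndex n) (f : AHat n U) (A : Finset (MultiIndex n))
    (m : JetIndex n →₀ ℕ) : MvPowerSeries.coeff m ((contrMulX T f).coeff A) =
      if T.1 + xiD n ∈ A ∨ m T = 0 then 0 else mergeSign {T.1 + xiD n} A •
        MvPowerSeries.coeff (m - Finsupp.single T 1) (f.coeff (insert (T.1 + xiD n) A)) := by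
  rw [contrMulX, contr_coeff]
  by_cases hA : T.1 + xiD n ∈ A
  · simp [hA]
  · rw [if_neg hA, map_zsmul, mapCoeff_coeff, coeff_mulX]
    by_cases hm : m T = 0 <;> simp [hA, hm]

/-- The homotopy `∑_{T ≠ 0} u^T ∂/∂θ^{T + ξ_D}`. -/
def eulerHomotopy (f : AHat n U) : AHat n U :=
  ⟨fun A m => ∑ T ∈ m.support, MvPowerSeries.coeff m ((contrMulX T f).coeff A)⟩

/-- Only those `T` for which `u^T` divides `u^m` contribute to the infinite sum. -/
theorem coeff_eulerHomotopy {F : Finset (JetIndex n)} {m : JetIndex n →₀ ℕ} (h : m.support ⊆ F)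
    (f : AHat n U) (A : Finset (MultiIndex n)) :
    MvPowerSeries.coeff m ((eulerHomotopy f).coeff A) =
      MvPowerSeries.coeff m ((∑ T ∈ F, contrMulX T f).coeff A) := by
  rw [sum_coeff, map_sum]
  change ∑ T ∈ m.support, MvPowerSeries.coeff m ((contrMulX T f).coeff A) = _
  refine Finset.sum_subset h fun T _ hT => ?_
  rw [coeff_contrMulX, if_pos (Or.inr (Finsupp.notMem_support_iff.1 hT))]

theorem eulerHomotopy_zero : eulerHomotopy (0 : AHat n U) = 0 :=
  ext_coeff fun A m => by
    rw [coeff_eulerHomotopy (le_refl m.support)]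
    simp [contrMulX]

/-- Differentiation by `u^S` reads the coefficient at `m + single S 1`, with `S + ξ_D ∈ A`; this is
why `F` must also contain `jetShiftPreimage A`. -/
theorem coeff_Delta_eulerHomotopy {F : Finset (JetIndex n)} {A : Finset (MultiIndex n)}
    {m : JetIndex n →₀ ℕ} (hm : m.support ⊆ F) (hA : jetShiftPreimage A ⊆ F) (f : AHat n U) :
    MvPowerSeries.coeff m ((Delta n U (eulerHomotopy f)).coeff A) =
      MvPowerSeries.coeff m ((Delta n U (∑ T ∈ F, contrMulX T f)).coeff A) := by
  classical
  rw [coeff_Delta, coeff_Delta]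
  refine Finset.sum_congr rfl fun S hS => congrArg _ ?_
  by_cases h0 : S = 0
  · subst h0
    rw [coeff_partialU_zero, coeff_partialU_zero, coeff_eulerHomotopy hm]
  · rw [coeff_partialU_of_ne h0, coeff_partialU_of_ne h0, coeff_eulerHomotopy]
    refine Finsupp.support_add.trans (Finset.union_subset hm ?_)
    refine Finsupp.support_single_subset.trans (Finset.singleton_subset_iff.2 (hA ?_))
    exact mem_jetShiftPreimage.2 (mem_shiftPreimage.1 hS)

/-- Multiplication of the coefficient of `u^m θ^A` by a real number `c A m`. -/
def scale (c : Finset (MultiIndex n) → (JetIndex n →₀ ℕ) → ℝ) (f : AHat n U) : AHat n U :=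
  ⟨fun A m => c A m • MvPowerSeries.coeff m (f.coeff A)⟩

theorem coeff_scale (c : Finset (MultiIndex n) → (JetIndex n →₀ ℕ) → ℝ) (f : AHat n U)
    (A : Finset (MultiIndex n)) (m : JetIndex n →₀ ℕ) :
    MvPowerSeries.coeff m ((scale c f).coeff A) = c A m • MvPowerSeries.coeff m (f.coeff A) := rfl

/-- The Euler formula. -/
theorem Delta_eulerHomotopy_add (f : AHat n U) :
    Delta n U (eulerHomotopy f) + eulerHomotopy (Delta n U f) =
      scale (fun A m => (weight A m : ℝ)) f := by
  classical
  refine ext_coeff fun A m => ?_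
  set F := m.support ∪ jetShiftPreimage A
  rw [add_coeff, map_add, coeff_Delta_eulerHomotopy (F := F) Finset.subset_union_left
    Finset.subset_union_right, coeff_eulerHomotopy (F := F) Finset.subset_union_left, map_sum,
    ← map_add, ← add_coeff, ← Finset.sum_add_distrib, sum_coeff, map_sum, coeff_scale]
  -- The operator is `∂_T u^T = 1 + u^T ∂_T` if `θ^{T+ξ_D}` occurs in `θ^A`, and `u^T ∂_T`
  -- otherwise; the extra 1 counts that `θ`.
  have hterm : ∀ T ∈ F, MvPowerSeries.coeff m
      ((Delta n U (contrMulX T f) + contrMulX T (Delta n U f)).coeff A) =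
      ((m T : ℝ) + if T ∈ jetShiftPreimage A then 1 else 0) •
        MvPowerSeries.coeff m (f.coeff A) := by
    intro T _
    rw [contrMulX, contrMulX, Delta_contr_add_contr_Delta T.1 (mulX T)
      (fun S hS f => partialU_mulX_of_ne hS f), partialU_mulX_self]
    simp only [mem_jetShiftPreimage]
    split_ifs with h
    · rw [map_add, coeff_mulX_partialU, add_smul, one_smul, add_comm]
    · rw [coeff_mulX_partialU, add_zero]
  rw [Finset.sum_congr rfl hterm, ← Finset.sum_smul, Finset.sum_add_distrib, weight]
  congr 1
  rw [Nat.cast_add, Finsupp.degree_apply]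
  congr 1
  · rw [Nat.cast_sum]
    refine (Finset.sum_subset Finset.subset_union_left fun T _ hT => ?_).symm
    rw [Finsupp.notMem_support_iff.1 hT, Nat.cast_zero]
  · rw [← Finset.sum_filter, Finset.filter_mem_eq_inter,
      Finset.inter_eq_right.2 Finset.subset_union_right]
    simp

theorem weight_erase_xiD (A : Finset (MultiIndex n)) (m : JetIndex n →₀ ℕ) :
    weight (A.erase (0 + xiD n)) m = weight A m := by
  have h : jetShiftPreimage (A.erase (0 + xiD n)) = jetShiftPreimage A := by
    ext T
    rw [mem_jetShiftPreimage, mem_jetShiftPreimage, Finset.mem_erase]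
    exact and_iff_right fun h => T.2 (add_right_cancel h)
  rw [weight, weight, h]

/-- A term of `Δ` trades one factor `u^S` for one factor `θ^{S+ξ_D}`, and both count once. -/
theorem weight_erase_add_single {A : Finset (MultiIndex n)} {S : JetIndex n}
    (hS : S.1 + xiD n ∈ A) (m : JetIndex n →₀ ℕ) :
    weight (A.erase (S.1 + xiD n)) (m + Finsupp.single S 1) = weight A m := by
  classical
  have h : jetShiftPreimage (A.erase (S.1 + xiD n)) = (jetShiftPreimage A).erase S := by
    ext T
    rw [mem_jetShiftPreimage, Finset.mem_erase, Finset.mem_erase, mem_jetShiftPreimage]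
    refine and_congr_left fun _ => not_congr ⟨fun h => Subtype.ext (add_right_cancel h), ?_⟩
    rintro rfl
    rfl
  have hc := Finset.card_erase_add_one (mem_jetShiftPreimage.2 hS)
  rw [weight, weight, h, map_add, Finsupp.degree_single]
  omega

/-- Since `Δ` preserves the weight, it commutes with every function of it; used for the inverse
weight and for the projection to weight zero. -/
theorem Delta_scale_weight (φ : ℕ → ℝ) (f : AHat n U) :
    Delta n U (scale (fun A m => φ (weight A m)) f) =
      scale (fun A m => φ (weight A m)) (Delta n U f) := by
  refine ext_coeff fun A m => ?_
  rw [coeff_scale, coeff_Delta, coeff_Delta, Finset.smul_sum]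
  refine Finset.sum_congr rfl fun S hS => ?_
  rw [smul_comm (φ _) (mergeSign _ _)]
  congr 1
  by_cases h0 : S = 0
  · subst h0
    rw [coeff_partialU_zero, coeff_partialU_zero, coeff_scale, weight_erase_xiD, map_smul]
  · rw [coeff_partialU_of_ne h0, coeff_partialU_of_ne h0, coeff_scale,
      weight_erase_add_single (S := ⟨S, h0⟩) (mem_shiftPreimage.1 hS), smul_comm]

/-- The contraction by `θ^{ξ_D}` combined with integration of the coefficient functions. -/
def contrIntegral (I : Smooth U →ₗ[ℝ] Smooth U) (f : AHat n U) : AHat n U :=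
  contr (0 + xiD n) (mapCoeff (mapSmooth I) f)

/-- The homotopy between the identity and the projection onto the constant series in the `θ^S`,
`S ∈ Z_D`. -/
def homotopy (I : Smooth U →ₗ[ℝ] Smooth U) (f : AHat n U) : AHat n U :=
  eulerHomotopy (scale (fun A m => ((weight A m : ℝ))⁻¹) f) +
    contrIntegral I (scale (fun A m => if weight A m = 0 then 1 else 0) f)

/-- The constant term at `x₀` of the coefficient of `θ^A` if `A ⊆ Z_D`, and zero otherwise. -/
def constCoeff (x₀ : U) (A : Finset (MultiIndex n)) : AHat n U →ₗ[ℝ] ℝ :=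
  open Classical in
  { toFun := fun f =>
      if ∀ S ∈ A, S (Fin.last n) = 0 then MvPowerSeries.coeff 0 (f.coeff A) x₀ else 0
    map_add' := fun f g => by split_ifs <;> simp
    map_smul' := fun r f => by
      split_ifs
      · rfl
      · simp }

theorem constCoeff_of_forall {x₀ : U} {A : Finset (MultiIndex n)}
    (h : ∀ S ∈ A, S (Fin.last n) = 0) (f : AHat n U) :
    constCoeff x₀ A f = MvPowerSeries.coeff 0 (f.coeff A) x₀ := if_pos h

theorem constCoeff_of_not_forall {x₀ : U} {A : Finset (MultiIndex n)}
    (h : ¬ ∀ S ∈ A, S (Fin.last n) = 0) (f : AHat n U) : constCoeff x₀ A f = 0 := if_neg h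

/-- The specialization `u^S ↦ 0` (`S ≠ 0`), `u ↦ x₀`, `θ^{S + ξ_D} ↦ 0`. -/
def specialize (x₀ : U) : AHat n U →ₗ[ℝ] AHat n U where
  toFun f := ⟨fun A => algebraMap ℝ (DiffSeries n U) (constCoeff x₀ A f)⟩
  map_add' f g := GrassmannSeries.ext' fun A => by simp
  map_smul' r f := GrassmannSeries.ext' fun A => by
    change algebraMap ℝ (DiffSeries n U) (constCoeff x₀ A (r • f)) =
      r • algebraMap ℝ (DiffSeries n U) (constCoeff x₀ A f)
    rw [map_smul, smul_eq_mul, map_mul, Algebra.smul_def]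

theorem specialize_coeff (x₀ : U) (f : AHat n U) (A : Finset (MultiIndex n)) :
    (specialize x₀ f).coeff A = algebraMap ℝ (DiffSeries n U) (constCoeff x₀ A f) := rfl

theorem coeff_algebraMap [DecidableEq (JetIndex n →₀ ℕ)] (r : ℝ) (m : JetIndex n →₀ ℕ) :
    MvPowerSeries.coeff m (algebraMap ℝ (DiffSeries n U) r) =
      if m = 0 then algebraMap ℝ (Smooth U) r else 0 := by
  rw [MvPowerSeries.algebraMap_apply, MvPowerSeries.coeff_C]
  split_ifs <;> rfl

theorem exists_add_xiD {S : MultiIndex n} (h : S (Fin.last n) ≠ 0) : ∃ T, T + xiD n = S := by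
  refine ⟨S - xiD n, tsub_add_cancel_of_le fun i => ?_⟩
  by_cases hi : i = Fin.last n
  · subst hi
    simpa [xiD] using Nat.one_le_iff_ne_zero.2 h
  · simp [xiD, hi]

/-- Every multi-index outside `Z_D` is some `T + ξ_D`; the weight excludes those with `T ≠ 0`, and
the second condition excludes `ξ_D` itself. -/
theorem weight_eq_zero_and_iff {A : Finset (MultiIndex n)} {m : JetIndex n →₀ ℕ} :
    (weight A m = 0 ∧ 0 + xiD n ∉ A) ↔ m = 0 ∧ ∀ S ∈ A, S (Fin.last n) = 0 := by
  rw [weight, Nat.add_eq_zero_iff, Finsupp.degree_eq_zero_iff, Finset.card_eq_zero, and_assoc]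
  refine and_congr_right fun _ => ⟨fun ⟨h1, h2⟩ S hS => ?_, fun h => ⟨?_, fun h' => ?_⟩⟩
  · by_contra h
    obtain ⟨T, rfl⟩ := exists_add_xiD h
    by_cases hT : T = 0
    · exact h2 (hT ▸ hS)
    · exact Finset.notMem_empty _ (h1 ▸ mem_jetShiftPreimage (T := ⟨T, hT⟩).2 hS)
  · refine Finset.eq_empty_of_forall_notMem fun T hT => ?_
    simpa [xiD] using h _ (mem_jetShiftPreimage.1 hT)
  · simpa [xiD] using h _ h'

theorem coeff_specialize (x₀ : U) (f : AHat n U) (A : Finset (MultiIndex n))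
    (m : JetIndex n →₀ ℕ) : MvPowerSeries.coeff m ((specialize x₀ f).coeff A) =
      if weight A m = 0 ∧ 0 + xiD n ∉ A then
        algebraMap ℝ (Smooth U) (MvPowerSeries.coeff m (f.coeff A) x₀) else 0 := by
  classical
  rw [specialize_coeff, coeff_algebraMap, if_congr weight_eq_zero_and_iff rfl rfl]
  by_cases hm : m = 0
  · subst hm
    by_cases hA : ∀ S ∈ A, S (Fin.last n) = 0
    · rw [if_pos rfl, if_pos ⟨rfl, hA⟩, constCoeff_of_forall hA]
    · rw [if_pos rfl, if_neg fun h => hA h.2, constCoeff_of_not_forall hA, map_zero]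
  · rw [if_neg hm, if_neg fun h => hm h.1]

/-- This is the fundamental theorem of calculus in both orders: differentiating an integral returns
the function, while integrating a derivative loses the value at `x₀`. -/
theorem Delta_contrIntegral_add {I : Smooth U →ₗ[ℝ] Smooth U} {x₀ : U}
    (hI : ∀ f, smoothDeriv U (I f) = f)
    (hI' : ∀ f, I (smoothDeriv U f) = f - algebraMap ℝ (Smooth U) (f x₀)) (f : AHat n U)
    (A : Finset (MultiIndex n)) (m : JetIndex n →₀ ℕ) :
    MvPowerSeries.coeff m
        ((Delta n U (contrIntegral I f) + contrIntegral I (Delta n U f)).coeff A) =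
      MvPowerSeries.coeff m (f.coeff A) -
        if 0 + xiD n ∈ A then 0
        else algebraMap ℝ (Smooth U) (MvPowerSeries.coeff m (f.coeff A) x₀) := by
  rw [contrIntegral, contrIntegral, Delta_contr_add_contr_Delta 0 (mapSmooth I)
    (fun S hS f => partialU_mapSmooth_of_ne hS I f)]
  split_ifs
  · rw [coeff_partialU_zero, coeff_mapSmooth, hI, sub_zero]
  · rw [coeff_mapSmooth, coeff_partialU_zero, hI']

/-- A closed element is cohomologous to its specialization. -/
theorem eq_specialize_add_Delta_homotopy {I : Smooth U →ₗ[ℝ] Smooth U} {x₀ : U}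
    (hI : ∀ f, smoothDeriv U (I f) = f)
    (hI' : ∀ f, I (smoothDeriv U f) = f - algebraMap ℝ (Smooth U) (f x₀)) {f : AHat n U}
    (hf : Delta n U f = 0) : f = specialize x₀ f + Delta n U (homotopy I f) := by
  classical
  have hscale0 : ∀ c : Finset (MultiIndex n) → (JetIndex n →₀ ℕ) → ℝ,
      scale c (0 : AHat n U) = 0 := fun c => ext_coeff fun A m => by
    rw [coeff_scale]; simp
  -- Because `0⁻¹ = 0`, `f₁` has no part of weight zero, so `f₁` and `f₂` separate positive weight
  -- from weight zero; both remain closed.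
  set f₁ := scale (fun A m => ((weight A m : ℝ))⁻¹) f with hf₁
  set f₂ := scale (fun A m => if weight A m = 0 then (1 : ℝ) else 0) f with hf₂
  have h1 : Delta n U f₁ = 0 := by
    rw [hf₁, Delta_scale_weight (fun k => (k : ℝ)⁻¹), hf, hscale0]
  have h2 : Delta n U f₂ = 0 := by
    rw [hf₂, Delta_scale_weight (fun k => if k = 0 then (1 : ℝ) else 0), hf, hscale0]
  have e1 := Delta_eulerHomotopy_add f₁
  rw [h1, eulerHomotopy_zero, add_zero] at e1
  have e2 := Delta_contrIntegral_add hI hI' f₂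
  rw [h2] at e2
  refine ext_coeff fun A m => ?_
  have e3 := e2 A m
  rw [show contrIntegral I (0 : AHat n U) = 0 by simp [contrIntegral], add_zero, hf₂,
    coeff_scale] at e3
  rw [homotopy, map_add, add_coeff, add_coeff, map_add, map_add, ← hf₁, ← hf₂, e1, e3,
    coeff_scale, hf₁, coeff_scale, coeff_specialize]
  by_cases hw : weight A m = 0
  · by_cases hx : 0 + xiD n ∈ A <;> simp [hw]
  · simp [hw, smul_smul]

end Homotopy

/-! ### Bidegrees -/

section Degree

variable {n : ℕ} {U : TopologicalSpace.Opens ℝ}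

theorem len_add_xiD (S : MultiIndex n) : len (S + xiD n) = len S + 1 := by
  simp [len, xiD, Finset.sum_add_distrib]

/-- The standard degree of `u^m`. -/
def jetDegree (m : JetIndex n →₀ ℕ) : ℕ := m.sum fun S k => k * len S.1

theorem jetDegree_add (m m' : JetIndex n →₀ ℕ) :
    jetDegree (m + m') = jetDegree m + jetDegree m' :=
  Finsupp.sum_add_index' (fun _ => zero_mul _) fun _ _ _ => add_mul _ _ _

theorem jetDegree_single (S : JetIndex n) : jetDegree (Finsupp.single S 1) = len S.1 := by
  simp [jetDegree]

theorem mem_homog {p d : ℕ} {f : AHat n U} : f ∈ homog n U p d ↔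
    ∀ (A : Finset (MultiIndex n)) (m : JetIndex n →₀ ℕ), MvPowerSeries.coeff m (f.coeff A) ≠ 0 →
      A.card = p ∧ (∑ S ∈ A, len S) + jetDegree m = d := Iff.rfl

theorem Delta_mem_homog {p d : ℕ} {f : AHat n U} (hf : f ∈ homog n U p d) :
    Delta n U f ∈ homog n U (p + 1) (d + 1) := by
  rw [mem_homog] at hf ⊢
  intro A m h
  rw [coeff_Delta] at h
  obtain ⟨S, hS, hne⟩ := Finset.exists_ne_zero_of_sum_ne_zero h
  rw [mem_shiftPreimage] at hS
  have hne' : MvPowerSeries.coeff m (partialU S (f.coeff (A.erase (S + xiD n)))) ≠ 0 :=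
    fun h0 => hne (by rw [h0, smul_zero])
  have hcard := Finset.card_erase_add_one hS
  have hsum := Finset.sum_erase_add A len hS
  rw [len_add_xiD] at hsum
  by_cases h0 : S = 0
  · subst h0
    rw [coeff_partialU_zero] at hne'
    have := hf _ m fun h0 => hne' (by rw [h0, map_zero])
    have hl : len (0 : MultiIndex n) = 0 := by simp [len]
    omega
  · rw [coeff_partialU_of_ne h0] at hne'
    have := hf _ _ fun h0 => hne' (by rw [h0, smul_zero])
    rw [jetDegree_add, jetDegree_single] at this
    change _ ∧ _ + (_ + len S) = d at this
    omega

theorem scale_mem_homog {p d : ℕ} {f : AHat n U} (hf : f ∈ homog n U p d)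
    (c : Finset (MultiIndex n) → (JetIndex n →₀ ℕ) → ℝ) : scale c f ∈ homog n U p d :=
  fun A m h => hf A m fun h0 => h (by rw [coeff_scale, h0, smul_zero])

/-- Trading `θ^{T+ξ_D}` for `u^T` lowers both degrees by one. Writing `+ 1` on the left avoids
truncated subtraction and rules out `p = 0` and `d = 0`, where the homotopy must vanish. -/
theorem degree_of_coeff_eulerHomotopy_ne_zero {p d : ℕ} {f : AHat n U} (hf : f ∈ homog n U p d)
    {A : Finset (MultiIndex n)} {m : JetIndex n →₀ ℕ}
    (h : MvPowerSeries.coeff m ((eulerHomotopy f).coeff A) ≠ 0) :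
    A.card + 1 = p ∧ (∑ S ∈ A, len S) + jetDegree m + 1 = d := by
  rw [mem_homog] at hf
  rw [coeff_eulerHomotopy (le_refl m.support), sum_coeff, map_sum] at h
  obtain ⟨T, _, hne⟩ := Finset.exists_ne_zero_of_sum_ne_zero h
  rw [coeff_contrMulX] at hne
  split_ifs at hne with hT
  · exact absurd rfl hne
  rw [not_or] at hT
  have h1 := hf _ _ fun h0 => hne (by rw [h0, smul_zero])
  have hle : Finsupp.single T 1 ≤ m :=
    Finsupp.single_le_iff.2 (Nat.one_le_iff_ne_zero.2 hT.2)
  have h2 := jetDegree_add (m - Finsupp.single T 1) (Finsupp.single T 1)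
  rw [tsub_add_cancel_of_le hle, jetDegree_single] at h2
  rw [Finset.card_insert_of_notMem hT.1, Finset.sum_insert hT.1, len_add_xiD] at h1
  omega

theorem degree_of_coeff_contrIntegral_ne_zero {p d : ℕ} {f : AHat n U} (hf : f ∈ homog n U p d)
    {I : Smooth U →ₗ[ℝ] Smooth U} {A : Finset (MultiIndex n)} {m : JetIndex n →₀ ℕ}
    (h : MvPowerSeries.coeff m ((contrIntegral I f).coeff A) ≠ 0) :
    A.card + 1 = p ∧ (∑ S ∈ A, len S) + jetDegree m + 1 = d := by
  rw [mem_homog] at hf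
  rw [contrIntegral, contr_coeff] at h
  split_ifs at h with hT
  · exact absurd (map_zero _) h
  rw [map_zsmul, mapCoeff_coeff, coeff_mapSmooth] at h
  have h1 := hf _ _ fun h0 => h (by rw [h0, map_zero, smul_zero])
  have hl : len (0 : MultiIndex n) = 0 := by simp [len]
  rw [Finset.card_insert_of_notMem hT, Finset.sum_insert hT, len_add_xiD] at h1
  omega

theorem homotopy_mem_homogPred {p d : ℕ} {f : AHat n U} (hf : f ∈ homog n U p d)
    (I : Smooth U →ₗ[ℝ] Smooth U) : homotopy I f ∈ homogPred n U p d := by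
  have key : ∀ A (m : JetIndex n →₀ ℕ), MvPowerSeries.coeff m ((homotopy I f).coeff A) ≠ 0 →
      A.card + 1 = p ∧ (∑ S ∈ A, len S) + jetDegree m + 1 = d := by
    intro A m h
    rw [homotopy, add_coeff, map_add] at h
    by_cases h1 : MvPowerSeries.coeff m
        ((eulerHomotopy (scale (fun A m => ((weight A m : ℝ))⁻¹) f)).coeff A) = 0
    · rw [h1, zero_add] at h
      exact degree_of_coeff_contrIntegral_ne_zero (scale_mem_homog hf _) h
    · exact degree_of_coeff_eulerHomotopy_ne_zero (scale_mem_homog hf _) h1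
  match p, d with
  | p + 1, d + 1 =>
    refine mem_homog.2 fun A m h => ?_
    have := key A m h
    omega
  | 0, d =>
    refine (Submodule.mem_bot ℝ).2 (ext_coeff fun A m => ?_)
    by_contra h
    have := key A m h
    omega
  | p + 1, 0 =>
    refine (Submodule.mem_bot ℝ).2 (ext_coeff fun A m => ?_)
    by_contra h
    have := key A m h
    omega

/-! ### Finite sums of bihomogeneous elements -/

theorem homog_le_polyPart (p d : ℕ) : homog n U p d ≤ polyPart n U :=
  le_iSup₂_of_le p d le_rfl

theorem homogPred_le_polyPart (p d : ℕ) : homogPred n U p d ≤ polyPart n U := by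
  match p, d with
  | p + 1, d + 1 => exact homog_le_polyPart p d
  | 0, d => exact bot_le
  | p + 1, 0 => exact bot_le

theorem eulerHomotopy_add (f g : AHat n U) :
    eulerHomotopy (f + g) = eulerHomotopy f + eulerHomotopy g :=
  ext_coeff fun A m => by
    rw [add_coeff, map_add]
    simp only [coeff_eulerHomotopy (le_refl m.support), ← map_add, ← add_coeff,
      ← Finset.sum_add_distrib, contrMulX]

theorem homotopy_add (I : Smooth U →ₗ[ℝ] Smooth U) (f g : AHat n U) :
    homotopy I (f + g) = homotopy I f + homotopy I g := by
  have hs : ∀ c : Finset (MultiIndex n) → (JetIndex n →₀ ℕ) → ℝ,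
      scale c (f + g) = scale c f + scale c g := fun c => ext_coeff fun A m => by
    simp only [coeff_scale, add_coeff, map_add, smul_add]
  rw [homotopy, hs, hs, eulerHomotopy_add, contrIntegral, map_add, map_add, homotopy, homotopy,
    contrIntegral, contrIntegral]
  abel

theorem polyPart_induction {C : AHat n U → Prop} (hC : ∀ p d, ∀ f ∈ homog n U p d, C f)
    (h0 : C 0) (hadd : ∀ f g, C f → C g → C (f + g)) {f : AHat n U} (hf : f ∈ polyPart n U) :
    C f := by
  refine Submodule.iSup_induction _ (motive := C) hf (fun p f hf => ?_) h0 hadd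
  exact Submodule.iSup_induction _ (motive := C) hf (fun d f hf => hC p d f hf) h0 hadd

theorem homotopy_mem_polyPart {f : AHat n U} (hf : f ∈ polyPart n U)
    (I : Smooth U →ₗ[ℝ] Smooth U) : homotopy I f ∈ polyPart n U := by
  refine polyPart_induction (C := fun f => homotopy I f ∈ polyPart n U) ?_ ?_ ?_ hf
  · exact fun p d f hf => homogPred_le_polyPart p d (homotopy_mem_homogPred hf I)
  -- Zero lies in every bidegree; any choice of bidegree serves here.
  · exact homogPred_le_polyPart 0 0 (homotopy_mem_homogPred (zero_mem _) I)
  · intro f g hf hg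
    rw [homotopy_add]
    exact add_mem hf hg

theorem mul_mem_homog {p d p' d' : ℕ} {f g : AHat n U} (hf : f ∈ homog n U p d)
    (hg : g ∈ homog n U p' d') : f * g ∈ homog n U (p + p') (d + d') := by
  classical
  rw [mem_homog] at *
  intro A m h
  rw [mul_coeff, map_sum] at h
  obtain ⟨C, hC, h1⟩ := Finset.exists_ne_zero_of_sum_ne_zero h
  rw [map_zsmul, MvPowerSeries.coeff_mul] at h1
  obtain ⟨⟨k, l⟩, hkl, h2⟩ := Finset.exists_ne_zero_of_sum_ne_zero fun h0 => h1 (by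
    rw [h0, smul_zero])
  have hC' := Finset.mem_powerset.1 hC
  have hf' := hf C k (left_ne_zero_of_mul h2)
  have hg' := hg _ l (right_ne_zero_of_mul h2)
  have hcard := Finset.card_sdiff_add_card_eq_card hC'
  have hsum := Finset.sum_sdiff (f := len) hC'
  have hm : k + l = m := Finset.HasAntidiagonal.mem_antidiagonal.1 hkl
  rw [← hm, jetDegree_add]
  omega

theorem mul_mem_polyPart {f g : AHat n U} (hf : f ∈ polyPart n U) (hg : g ∈ polyPart n U) :
    f * g ∈ polyPart n U := by
  refine polyPart_induction (C := fun f => f * g ∈ polyPart n U) (fun p d f hf => ?_) ?_ ?_ hf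
  · refine polyPart_induction (C := fun g => f * g ∈ polyPart n U) (fun p' d' g hg => ?_) ?_ ?_ hg
    · exact homog_le_polyPart _ _ (mul_mem_homog hf hg)
    · rw [mul_zero]
      exact zero_mem _
    · intro g g' h h'
      rw [mul_add]
      exact add_mem h h'
  · rw [zero_mul]
    exact zero_mem _
  · intro f f' h h'
    rw [add_mul]
    exact add_mem h h'

end Degree

/-! ### The specialization -/

section Specialize

variable {n : ℕ} {U : TopologicalSpace.Opens ℝ}

/-- The constant term and evaluation at `x₀` are ring homomorphisms, and a splitting of `A` into two
subsets of `Z_D` exists only if `A` itself lies in `Z_D`. -/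
theorem constCoeff_mul (x₀ : U) (A : Finset (MultiIndex n)) (f g : AHat n U) :
    constCoeff x₀ A (f * g) = ∑ C ∈ A.powerset,
      mergeSign C (A \ C) • (constCoeff x₀ C f * constCoeff x₀ (A \ C) g) := by
  by_cases hA : ∀ S ∈ A, S (Fin.last n) = 0
  · let ev : Smooth U →+* ℝ :=
      { toFun := fun f => f x₀, map_zero' := rfl, map_one' := rfl, map_add' := fun _ _ => rfl,
        map_mul' := fun _ _ => rfl }
    rw [constCoeff_of_forall hA, mul_coeff]
    change ev (MvPowerSeries.constantCoeff _) = _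
    rw [map_sum, map_sum]
    refine Finset.sum_congr rfl fun C hC => ?_
    rw [map_zsmul, map_zsmul, map_mul, map_mul,
      constCoeff_of_forall fun S hS => hA S (Finset.mem_powerset.1 hC hS),
      constCoeff_of_forall fun S hS => hA S (Finset.mem_sdiff.1 hS).1]
    rfl
  · rw [constCoeff_of_not_forall hA]
    refine (Finset.sum_eq_zero fun C hC => ?_).symm
    by_cases h1 : ∀ S ∈ C, S (Fin.last n) = 0
    · by_cases h2 : ∀ S ∈ A \ C, S (Fin.last n) = 0
      · refine absurd (fun S hS => ?_) hA
        by_cases hSC : S ∈ C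
        · exact h1 S hSC
        · exact h2 S (Finset.mem_sdiff.2 ⟨hS, hSC⟩)
      · rw [constCoeff_of_not_forall h2, mul_zero, smul_zero]
    · rw [constCoeff_of_not_forall h1, zero_mul, smul_zero]

theorem specialize_mul (x₀ : U) (f g : AHat n U) :
    specialize x₀ (f * g) = specialize x₀ f * specialize x₀ g := by
  refine GrassmannSeries.ext' fun A => ?_
  simp only [specialize_coeff, constCoeff_mul, mul_coeff, map_sum, map_zsmul, map_mul]

theorem specialize_mem_thetaCompleted (x₀ : U) (f : AHat n U) :
    specialize x₀ f ∈ thetaCompleted n U := by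
  refine ⟨fun A => constCoeff x₀ A f, fun A hA => ?_, fun A => rfl⟩
  by_contra h
  exact hA (constCoeff_of_not_forall h f)

theorem specialize_of_mem (x₀ : U) {f : AHat n U} (hf : f ∈ thetaCompleted n U) :
    specialize x₀ f = f := by
  classical
  obtain ⟨c, hc, hfc⟩ := hf
  refine GrassmannSeries.ext' fun A => ?_
  rw [specialize_coeff, hfc]
  by_cases hA : ∀ S ∈ A, S (Fin.last n) = 0
  · rw [constCoeff_of_forall hA, hfc, coeff_algebraMap, if_pos rfl, algebraMap_smooth_apply]
  · rw [constCoeff_of_not_forall hA, not_not.1 (mt (hc A) hA)]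

/-- Every term of `Δ` carries a factor `θ^{S+ξ_D}`, which the specialization sets to zero. This
yields injectivity on cohomology. -/
theorem specialize_Delta (x₀ : U) (f : AHat n U) : specialize x₀ (Delta n U f) = 0 := by
  refine GrassmannSeries.ext' fun A => ?_
  rw [specialize_coeff]
  by_cases hA : ∀ S ∈ A, S (Fin.last n) = 0
  · have h : shiftPreimage A = ∅ := Finset.eq_empty_of_forall_notMem fun S hS => by
      simpa [xiD] using hA _ (mem_shiftPreimage.1 hS)
    rw [constCoeff_of_forall hA, coeff_Delta, h, Finset.sum_empty]
    exact map_zero _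
  · rw [constCoeff_of_not_forall hA, map_zero, zero_coeff]

theorem partialU_algebraMap (S : MultiIndex n) (r : ℝ) :
    partialU S (algebraMap ℝ (DiffSeries n U) r) = 0 := by
  have h1 : partialU S (1 : DiffSeries n U) = 0 := by
    simpa using partialU_mul S (1 : DiffSeries n U) 1
  rw [Algebra.algebraMap_eq_smul_one, map_smul, h1, smul_zero]

theorem Delta_of_mem_thetaCompleted {f : AHat n U} (hf : f ∈ thetaCompleted n U) :
    Delta n U f = 0 := by
  obtain ⟨c, _, hfc⟩ := hf
  refine ext_coeff fun A m => ?_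
  rw [coeff_Delta]
  refine (Finset.sum_eq_zero fun S _ => ?_).trans (map_zero _).symm
  rw [hfc, partialU_algebraMap, map_zero, smul_zero]

end Specialize

/-! ### The Grassmann algebra `Θ` inside `Â` -/

section ThetaIncl

variable {n : ℕ} {U : TopologicalSpace.Opens ℝ}

/-- The monomial `θ^A`. -/
def thetaMonomial (n : ℕ) (U : TopologicalSpace.Opens ℝ) (A : Finset (MultiIndex n)) : AHat n U :=
  ⟨fun C => if C = A then 1 else 0⟩

theorem theta_mul_thetaMonomial {S : MultiIndex n} {A : Finset (MultiIndex n)} (h : S ∉ A) :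
    theta S * thetaMonomial n U A = mergeSign {S} A • thetaMonomial n U (insert S A) := by
  refine GrassmannSeries.ext' fun C => ?_
  have hz : ∀ (k : ℤ) (f : AHat n U), (k • f).coeff C = k • f.coeff C := fun k f => by
    rw [← Int.cast_smul_eq_zsmul ℝ, ← Int.cast_smul_eq_zsmul ℝ, smul_coeff]
  rw [theta_mul_coeff, hz]
  by_cases hC : C = insert S A
  · subst hC
    simp [thetaMonomial, Finset.erase_insert h]
  · have h' : S ∈ C → C.erase S ≠ A := fun hS h' => hC (by rw [← h', Finset.insert_erase hS])
    split_ifs with hS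
    · simp [thetaMonomial, hC, h' hS]
    · simp [thetaMonomial, hC]

/-- The sign is left unspecified: only its invertibility matters later. -/
theorem prod_map_theta {l : List (MultiIndex n)} (hl : l.Nodup) :
    ∃ ε : ℤ, ε * ε = 1 ∧
      (l.map theta).prod = ε • thetaMonomial n U l.toFinset := by
  induction l with
  | nil => exact ⟨1, one_mul 1, by rw [one_smul]; rfl⟩
  | cons S l ih =>
    rw [List.nodup_cons] at hl
    obtain ⟨ε, hε, h⟩ := ih hl.2
    refine ⟨ε * mergeSign {S} l.toFinset, ?_, ?_⟩
    · rw [mul_mul_mul_comm, hε, mergeSign_mul_self, one_mul]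
    · rw [List.map_cons, List.prod_cons, h, mul_smul_comm,
        theta_mul_thetaMonomial (by simpa using hl.1), smul_smul, List.toFinset_cons]

theorem thetaIncl_ι_single (S : ZD n) :
    thetaIncl n U (ExteriorAlgebra.ι ℝ (Finsupp.single S 1)) = theta S.1 := by
  rw [thetaIncl, ExteriorAlgebra.lift_ι_apply, thetaLin, Finsupp.linearCombination_single,
    one_smul]

theorem thetaIncl_ιMulti {p : ℕ} (S : Fin p → ZD n) :
    thetaIncl n U (ExteriorAlgebra.ιMulti ℝ p fun i => Finsupp.single (S i) 1) =
      ((List.ofFn fun i => (S i).1).map theta).prod := by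
  rw [ExteriorAlgebra.ιMulti_apply, map_list_prod, List.map_ofFn, List.map_ofFn]
  congr 2
  funext i
  exact thetaIncl_ι_single (S i)

theorem thetaIncl_ιMulti_of_injective {p : ℕ} {S : Fin p → ZD n} (hS : Function.Injective S) :
    ∃ ε : ℤ, ε * ε = 1 ∧
      thetaIncl n U (ExteriorAlgebra.ιMulti ℝ p fun i => Finsupp.single (S i) 1) =
        ε • thetaMonomial n U (Finset.univ.image fun i => (S i).1) := by
  obtain ⟨ε, hε, h⟩ := prod_map_theta (U := U)
    (List.nodup_ofFn.2 (Subtype.val_injective.comp hS))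
  refine ⟨ε, hε, ?_⟩
  rw [thetaIncl_ιMulti]
  refine h.trans ?_
  congr 2
  ext T
  simp [List.mem_ofFn]

/-- `Z_D` with the lexicographic order. -/
abbrev ZDLex (n : ℕ) : Type := {S : Lex (MultiIndex n) // ofLex S (Fin.last n) = 0}

/-- The basis of `Θ` consisting of the monomials. -/
def thetaBasis (n : ℕ) : Module.Basis (Finset (ZDLex n)) ℝ (Theta n) :=
  ((Finsupp.basisSingleOne : Module.Basis (ZD n) ℝ (ZD n →₀ ℝ)).reindex
    (toLex.subtypeEquiv fun _ => Iff.rfl : ZD n ≃ ZDLex n)).ExteriorAlgebra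

/-- This presents the basis vectors in the form of the spanning monomials of `thetaHomog`, and
records which set of generators each one involves. -/
theorem thetaBasis_apply (s : Finset (ZDLex n)) :
    ∃ S : Fin s.card → ZD n, Function.Injective S ∧
      Finset.univ.image (fun i => (S i).1) = s.image (fun T => ofLex T.1) ∧
      thetaBasis n s = ExteriorAlgebra.ιMulti ℝ s.card fun i => Finsupp.single (S i) 1 := by
  let e : ZD n ≃ ZDLex n := toLex.subtypeEquiv fun _ => Iff.rfl
  refine ⟨fun i => e.symm (s.orderEmbOfFin rfl i),
    e.symm.injective.comp (s.orderEmbOfFin rfl).injective, ?_, ?_⟩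
  · have h : s = Finset.univ.image (s.orderEmbOfFin rfl) := by
      ext T
      have hT := Set.ext_iff.1 (Finset.range_orderEmbOfFin s rfl) T
      rw [Finset.mem_image, ← Finset.mem_coe, ← hT]
      simp
    conv_rhs => rw [h, Finset.image_image]
    rfl
  · rw [thetaBasis, ExteriorAlgebra.basis_apply]
    change ExteriorAlgebra.ιMulti ℝ s.card _ = _
    congr 1
    funext i
    refine (Module.Basis.reindex_apply _ _ _).trans ?_
    rw [Finsupp.coe_basisSingleOne]
    rfl

theorem constCoeff_thetaMonomial (x₀ : U) {A : Finset (MultiIndex n)}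
    (hA : ∀ S ∈ A, S (Fin.last n) = 0) (C : Finset (MultiIndex n)) :
    constCoeff x₀ A (thetaMonomial n U C) = if A = C then 1 else 0 := by
  classical
  rw [constCoeff_of_forall hA]
  change MvPowerSeries.coeff 0 (if A = C then 1 else 0 : DiffSeries n U) x₀ = _
  split_ifs
  · rw [MvPowerSeries.coeff_zero_one]
    rfl
  · rfl

/-- Distinct basis monomials of `Θ` go, up to sign, to distinct `θ^A`, so the coefficient
functionals on `Â` recover the coordinates. -/
theorem thetaIncl_injective (x₀ : U) : Function.Injective (thetaIncl n U) := by
  classical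
  rw [injective_iff_map_eq_zero]
  intro t ht
  refine (thetaBasis n).ext_elem fun s => ?_
  have hinj : Function.Injective fun s : Finset (ZDLex n) => s.image fun T => ofLex T.1 :=
    Finset.image_injective (ofLex.injective.comp Subtype.val_injective)
  have hs : ∀ S ∈ s.image (fun T => ofLex T.1), S (Fin.last n) = 0 := by
    intro S hS
    obtain ⟨T, _, rfl⟩ := Finset.mem_image.1 hS
    exact T.2
  obtain ⟨S, hS, hS', hSs⟩ := thetaBasis_apply s
  obtain ⟨ε, hε, h⟩ := thetaIncl_ιMulti_of_injective (U := U) hS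
  have key : (constCoeff x₀ (s.image fun T => ofLex T.1)) ∘ₗ (thetaIncl n U).toLinearMap =
      (ε : ℝ) • (thetaBasis n).coord s := by
    refine (thetaBasis n).ext fun s' => ?_
    rw [LinearMap.comp_apply, LinearMap.smul_apply, Module.Basis.coord_apply,
      Module.Basis.repr_self]
    change constCoeff x₀ _ (thetaIncl n U (thetaBasis n s')) = _
    by_cases hss : s' = s
    · subst hss
      rw [hSs, h, map_zsmul, constCoeff_thetaMonomial x₀ hs, if_pos hS'.symm]
      simp
    · obtain ⟨S₁, hS₁, hS₁', hSs₁⟩ := thetaBasis_apply s'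
      obtain ⟨ε₁, -, h₁⟩ := thetaIncl_ιMulti_of_injective (U := U) hS₁
      rw [hSs₁, h₁, map_zsmul, constCoeff_thetaMonomial x₀ hs, hS₁',
        if_neg fun h => hss (hinj h).symm, Finsupp.single_eq_of_ne (Ne.symm hss)]
      simp
  have h0 := LinearMap.congr_fun key t
  change constCoeff x₀ _ (thetaIncl n U t) = (ε : ℝ) * (thetaBasis n).repr t s at h0
  rw [ht, map_zero] at h0
  have hε0 : (ε : ℝ) ≠ 0 := by
    rintro h
    rw [Int.cast_eq_zero] at h
    simp [h] at hε
  simpa using (mul_eq_zero.1 h0.symm).resolve_left hε0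

/-! ### Bidegrees of the image of `Θ` -/

theorem theta_mem_homog (S : MultiIndex n) : (theta S : AHat n U) ∈ homog n U 1 (len S) := by
  classical
  refine mem_homog.2 fun A m h => ?_
  change MvPowerSeries.coeff m (if A = {S} then 1 else 0 : DiffSeries n U) ≠ 0 at h
  split_ifs at h with hA
  · rw [MvPowerSeries.coeff_one] at h
    have hm : m = 0 := by
      by_contra h'
      exact h (if_neg h')
    simp [hA, hm, jetDegree]
  · exact absurd (map_zero _) h

theorem one_mem_homog : (1 : AHat n U) ∈ homog n U 0 0 := by
  classical
  refine mem_homog.2 fun A m h => ?_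
  rw [one_coeff] at h
  split_ifs at h with hA
  · rw [MvPowerSeries.coeff_one] at h
    have hm : m = 0 := by
      by_contra h'
      exact h (if_neg h')
    simp [hA, hm, jetDegree]
  · exact absurd (map_zero _) h

theorem prod_map_theta_mem_homog (l : List (MultiIndex n)) :
    ((l.map theta).prod : AHat n U) ∈ homog n U l.length (l.map len).sum := by
  induction l with
  | nil => exact one_mem_homog
  | cons S l ih =>
    simp only [List.map_cons, List.prod_cons, List.length_cons, List.sum_cons]
    rw [add_comm l.length 1]
    exact mul_mem_homog (theta_mem_homog S) ih

theorem thetaIncl_mem_homog {p d : ℕ} {t : Theta n} (ht : t ∈ thetaHomog n p d) :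
    thetaIncl n U t ∈ homog n U p d := by
  have h : thetaHomog n p d ≤ (homog n U p d).comap (thetaIncl n U).toLinearMap := by
    refine Submodule.span_le.2 ?_
    rintro _ ⟨S, hS, rfl⟩
    change thetaIncl n U _ ∈ homog n U p d
    have h := prod_map_theta_mem_homog (U := U) (List.ofFn fun i => (S i).1)
    rw [List.length_ofFn, List.map_ofFn, List.sum_ofFn] at h
    rw [thetaIncl_ιMulti, ← hS]
    exact h
  exact h ht

theorem thetaIncl_mem_polyPart (t : Theta n) : thetaIncl n U t ∈ polyPart n U := by
  have h := (thetaBasis n).mem_span t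
  refine Submodule.span_induction (fun x hx => ?_) ?_ ?_ ?_ h
  · obtain ⟨s, rfl⟩ := hx
    obtain ⟨S, -, -, hS⟩ := thetaBasis_apply s
    rw [hS]
    exact homog_le_polyPart _ _
      (thetaIncl_mem_homog (Submodule.subset_span ⟨S, rfl, rfl⟩))
  · rw [map_zero]
    exact zero_mem _
  · intro x y _ _ hx hy
    rw [map_add]
    exact add_mem hx hy
  · intro r x _ hx
    rw [map_smul]
    exact Submodule.smul_mem _ r hx

theorem thetaIncl_mem_thetaCompleted (t : Theta n) : thetaIncl n U t ∈ thetaCompleted n U := by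
  classical
  have hS : ∀ S : ZD n, (theta S.1 : AHat n U) ∈ thetaCompleted n U := by
    intro S
    refine ⟨fun A => if A = {S.1} then 1 else 0, fun A hA T hT => ?_, fun A => ?_⟩
    · have hA' : A = {S.1} := by
        by_contra h
        exact hA (if_neg h)
      rw [hA', Finset.mem_singleton] at hT
      exact hT ▸ S.2
    · rw [apply_ite (algebraMap ℝ (DiffSeries n U)), map_one, map_zero]
      rfl
  induction t using ExteriorAlgebra.induction with
  | algebraMap r =>
    rw [AlgHom.commutes]
    exact Subalgebra.algebraMap_mem _ r
  | ι v =>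
    induction v using Finsupp.induction_linear with
    | zero => simp
    | add v w hv hw =>
      rw [map_add, map_add]
      exact add_mem hv hw
    | single S r =>
      rw [← mul_one r, ← smul_eq_mul, ← Finsupp.smul_single, map_smul, map_smul,
        thetaIncl_ι_single]
      exact Subalgebra.smul_mem _ (hS S) r
  | mul a b ha hb =>
    rw [map_mul]
    exact mul_mem ha hb
  | add a b ha hb =>
    rw [map_add]
    exact add_mem ha hb

theorem thetaMonomial_mem_map {p d : ℕ} {A : Finset (MultiIndex n)}
    (hA : ∀ S ∈ A, S (Fin.last n) = 0) (hp : A.card = p) (hd : ∑ S ∈ A, len S = d) :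
    thetaMonomial n U A ∈ (thetaHomog n p d).map (thetaIncl n U).toLinearMap := by
  subst hp
  let S : Fin A.card → ZD n := fun i => ⟨A.equivFin.symm i, hA _ (A.equivFin.symm i).2⟩
  have hS : Function.Injective S := fun i j h =>
    A.equivFin.symm.injective (Subtype.ext (congrArg (fun T : ZD n => T.1) h))
  have himg : Finset.univ.image (fun i => (S i).1) = A := by
    ext T
    simp only [Finset.mem_image, Finset.mem_univ, true_and]
    constructor
    · rintro ⟨i, rfl⟩
      exact (A.equivFin.symm i).2
    · intro hT
      exact ⟨A.equivFin ⟨T, hT⟩, by simp [S]⟩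
  obtain ⟨ε, hε, h⟩ := thetaIncl_ιMulti_of_injective (U := U) hS
  rw [himg] at h
  have hdeg : ∑ i, len (S i).1 = d := by
    have h := Finset.sum_image (s := Finset.univ) (g := fun i => (S i).1) (f := len)
      fun i _ j _ h => hS (Subtype.ext h)
    rw [← h, himg, hd]
  -- Since `ε * ε = 1`, a second factor `ε` cancels the reordering sign.
  refine ⟨(ε : ℝ) • ExteriorAlgebra.ιMulti ℝ A.card fun i => Finsupp.single (S i) 1,
    Submodule.smul_mem _ _ (Submodule.subset_span ⟨S, hdeg, rfl⟩), ?_⟩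
  rw [map_smul]
  change (ε : ℝ) • thetaIncl n U _ = _
  rw [h, Int.cast_smul_eq_zsmul, smul_smul, hε, one_smul]

/-- All entries of all members of `A` are at most `d`, so `A` is a subset of a finite box. Hence a
homogeneous specialization is a finite sum and comes from `Θ`, not merely from its completion. -/
theorem finite_card_sum_len (p d : ℕ) :
    {A : Finset (MultiIndex n) | A.card = p ∧ ∑ S ∈ A, len S = d}.Finite := by
  refine (Finset.finite_toSet
    (Fintype.piFinset fun _ : Fin (n + 1) => Finset.range (d + 1)).powerset).subset ?_
  rintro A ⟨-, hA⟩
  refine Finset.mem_coe.2 (Finset.mem_powerset.2 fun S hS => ?_)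
  refine Fintype.mem_piFinset.2 fun i => Finset.mem_range.2 (Nat.lt_succ_of_le ?_)
  calc S i ≤ len S := Finset.single_le_sum (fun _ _ => Nat.zero_le _) (Finset.mem_univ i)
    _ ≤ ∑ S ∈ A, len S := Finset.single_le_sum (f := len) (fun _ _ => Nat.zero_le _) hS
    _ = d := hA

theorem specialize_mem_map {p d : ℕ} (x₀ : U) {f : AHat n U} (hf : f ∈ homog n U p d) :
    specialize x₀ f ∈ (thetaHomog n p d).map (thetaIncl n U).toLinearMap := by
  classical
  have hsupp : ∀ A, constCoeff x₀ A f ≠ 0 → (∀ S ∈ A, S (Fin.last n) = 0) ∧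
      A.card = p ∧ ∑ S ∈ A, len S = d := by
    intro A h
    have hA : ∀ S ∈ A, S (Fin.last n) = 0 := by
      by_contra hA
      exact h (constCoeff_of_not_forall hA f)
    rw [constCoeff_of_forall hA] at h
    have h' := mem_homog.1 hf A 0 fun h0 => h (by rw [h0]; rfl)
    simp only [jetDegree, Finsupp.sum_zero_index, add_zero] at h'
    exact ⟨hA, h'⟩
  have hsum : specialize x₀ f = ∑ A ∈ (finite_card_sum_len (n := n) p d).toFinset,
      constCoeff x₀ A f • thetaMonomial n U A := by
    refine GrassmannSeries.ext' fun C => ?_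
    rw [sum_coeff, specialize_coeff]
    have hterm : ∀ A, (constCoeff x₀ A f • thetaMonomial n U A).coeff C =
        if C = A then algebraMap ℝ (DiffSeries n U) (constCoeff x₀ C f) else 0 := by
      intro A
      change constCoeff x₀ A f • (if C = A then 1 else 0 : DiffSeries n U) = _
      split_ifs with h
      · rw [h, Algebra.algebraMap_eq_smul_one]
      · rw [smul_zero]
    simp only [hterm, Finset.sum_ite_eq]
    split_ifs with hC
    · rfl
    · have h0 : constCoeff x₀ C f = 0 := by
        by_contra h
        exact hC ((Set.Finite.mem_toFinset _).2 (hsupp C h).2)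
      rw [h0, map_zero]
  rw [hsum]
  refine Submodule.sum_mem _ fun A _ => ?_
  by_cases h : constCoeff x₀ A f = 0
  · rw [h, zero_smul]
    exact zero_mem _
  · obtain ⟨h1, h2, h3⟩ := hsupp A h
    exact Submodule.smul_mem _ _ (thetaMonomial_mem_map h1 h2 h3)

theorem specialize_mem_range (x₀ : U) {f : AHat n U} (hf : f ∈ polyPart n U) :
    ∃ t, thetaIncl n U t = specialize x₀ f := by
  refine polyPart_induction (C := fun f => ∃ t, thetaIncl n U t = specialize x₀ f) ?_ ?_ ?_ hf
  · intro p d f hf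
    obtain ⟨t, -, ht⟩ := specialize_mem_map x₀ hf
    exact ⟨t, ht⟩
  · exact ⟨0, by rw [map_zero, map_zero]⟩
  · rintro f g ⟨t, ht⟩ ⟨t', ht'⟩
    exact ⟨t + t', by rw [map_add, map_add, ht, ht']⟩

end ThetaIncl

/-! ### The cohomology -/

section CohomologyEquiv

variable {n : ℕ} {U : TopologicalSpace.Opens ℝ}

theorem mem_cocycles {V : Submodule ℝ (AHat n U)} {a : AHat n U} :
    a ∈ cocycles V ↔ a ∈ V ∧ Delta n U a = 0 := Iff.rfl

theorem cls_eq_cls_iff {V W : Submodule ℝ (AHat n U)} {a b : AHat n U} (ha : a ∈ cocycles V)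
    (hb : b ∈ cocycles V) :
    (cls a ha : Cohomology V W) = cls b hb ↔ ∃ g ∈ W, Delta n U g = a - b :=
  Submodule.Quotient.eq _

/-- A space of representatives that are fixed by the specialization is isomorphic to the
cohomology, provided that it contains the specialization of every cocycle and that the homotopy
takes cocycles to admissible primitives. -/
theorem exists_cohomologyEquiv {I : Smooth U →ₗ[ℝ] Smooth U} {x₀ : U}
    (hI : ∀ f, smoothDeriv U (I f) = f)
    (hI' : ∀ f, I (smoothDeriv U f) = f - algebraMap ℝ (Smooth U) (f x₀))
    {X : Type*} [AddCommGroup X] [Module ℝ X] (j : X →ₗ[ℝ] AHat n U) (hj : Function.Injective j)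
    (V W : Submodule ℝ (AHat n U)) (hjV : ∀ x, j x ∈ V)
    (hjc : ∀ x, j x ∈ thetaCompleted n U)
    (hV : ∀ a ∈ V, ∃ x, j x = specialize x₀ a) (hW : ∀ a ∈ V, homotopy I a ∈ W) :
    ∃ e : X ≃ₗ[ℝ] Cohomology V W,
      (∀ x, ∃ h : j x ∈ cocycles V, e x = cls (j x) h) ∧
      ∀ a (ha : a ∈ cocycles V), j (e.symm (cls a ha)) = specialize x₀ a := by
  have hjz : ∀ x, j x ∈ cocycles V := fun x => ⟨hjV x, Delta_of_mem_thetaCompleted (hjc x)⟩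
  let φ : X →ₗ[ℝ] Cohomology V W := (Submodule.mkQ _) ∘ₗ j.codRestrict (cocycles V) hjz
  have hφ : ∀ x, φ x = cls (j x) (hjz x) := fun x => rfl
  have hcls : ∀ a (ha : a ∈ cocycles V) x, j x = specialize x₀ a → φ x = cls a ha := by
    -- The homotopy is an explicit primitive of the difference between a cocycle and its
    -- specialization.
    intro a ha x hx
    rw [hφ, eq_comm, cls_eq_cls_iff]
    refine ⟨homotopy I a, hW a ha.1, ?_⟩
    rw [hx]
    exact eq_sub_of_add_eq' (eq_specialize_add_Delta_homotopy hI hI' ha.2).symm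
  have hinj : Function.Injective φ := by
    intro x y hxy
    rw [hφ, hφ, cls_eq_cls_iff] at hxy
    obtain ⟨g, -, hg⟩ := hxy
    -- The specialization kills the coboundary and fixes both representatives, forcing them to
    -- agree.
    have h := congrArg (specialize x₀) hg
    rw [specialize_Delta, map_sub, specialize_of_mem x₀ (hjc x), specialize_of_mem x₀ (hjc y)] at h
    exact hj (sub_eq_zero.1 h.symm)
  have hsurj : Function.Surjective φ := by
    intro c
    obtain ⟨⟨a, ha⟩, rfl⟩ := Submodule.Quotient.mk_surjective _ c
    obtain ⟨x, hx⟩ := hV a ha.1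
    exact ⟨x, hcls a ha x hx⟩
  refine ⟨LinearEquiv.ofBijective φ ⟨hinj, hsurj⟩, fun x => ⟨hjz x, rfl⟩, fun a ha => ?_⟩
  obtain ⟨x, hx⟩ := hV a ha.1
  have he : LinearEquiv.ofBijective φ ⟨hinj, hsurj⟩ x = cls a ha := hcls a ha x hx
  rw [← he, LinearEquiv.symm_apply_apply, hx]

theorem mul_mem_cocycles {V : Submodule ℝ (AHat n U)} (hV : ∀ a ∈ V, ∀ b ∈ V, a * b ∈ V)
    {a b : AHat n U} (ha : a ∈ cocycles V) (hb : b ∈ cocycles V) : a * b ∈ cocycles V := by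
  rw [mem_cocycles] at *
  refine ⟨hV a ha.1 b hb.1, ?_⟩
  rw [Delta_mul, ha.2, hb.2, zero_mul, mul_zero, add_zero]

end CohomologyEquiv

end ScalarPoisson

end

open ScalarPoisson in
theorem mainTheorem4 (n : ℕ) (U : TopologicalSpace.Opens ℝ) (hU : IsConnected (U : Set ℝ)) :
    -- `Δ` is a differential of bidegree `(1, 1)`
    (∀ a : AHat n U, Delta n U (Delta n U a) = 0) ∧
    (∀ (p d : ℕ), ∀ a ∈ homog n U p d, Delta n U a ∈ homog n U (p + 1) (d + 1)) ∧
    -- the inclusion of `Θ` induces isomorphisms `Θ^p_d ≃ H^p_d(Â)`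
    (∀ p d : ℕ, ∃ e : thetaHomog n p d ≃ₗ[ℝ] bigradedH n U p d,
      ∀ t : thetaHomog n p d, ∃ h : thetaIncl n U t ∈ cocycles (homog n U p d),
        e t = cls (thetaIncl n U t) h) ∧
    -- the inclusion of `Θ` induces an isomorphism of algebras onto the total cohomology of
    -- the direct sum of the bihomogeneous components
    (∃ e : Theta n ≃ₗ[ℝ] Cohomology (polyPart n U) (polyPart n U),
      (∀ t : Theta n, ∃ h : thetaIncl n U t ∈ cocycles (polyPart n U),
        e t = cls (thetaIncl n U t) h) ∧
      ∀ (a b : AHat n U) (ha : a ∈ cocycles (polyPart n U)) (hb : b ∈ cocycles (polyPart n U)),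
        ∃ hab : a * b ∈ cocycles (polyPart n U),
          e.symm (cls (a * b) hab) = e.symm (cls a ha) * e.symm (cls b hb)) ∧
    -- the same for all formal series, with `Θ` replaced by its completion
    (∃ e : thetaCompleted n U ≃ₗ[ℝ] Cohomology (⊤ : Submodule ℝ (AHat n U)) ⊤,
      (∀ t : thetaCompleted n U, ∃ h : (t : AHat n U) ∈ cocycles ⊤,
        e t = cls (t : AHat n U) h) ∧
      ∀ (a b : AHat n U) (ha : a ∈ cocycles ⊤) (hb : b ∈ cocycles ⊤),
        ∃ hab : a * b ∈ cocycles ⊤,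
          e.symm (cls (a * b) hab) = e.symm (cls a ha) * e.symm (cls b hb)) := by
  obtain ⟨x, hx⟩ := hU.nonempty
  let x₀ : U := ⟨x, hx⟩
  obtain ⟨I, hI, hI'⟩ := exists_antiderivative hU.isPreconnected x₀
  have hinj : Function.Injective (thetaIncl n U) := thetaIncl_injective x₀
  refine ⟨Delta_Delta, fun p d a ha => Delta_mem_homog ha, fun p d => ?_, ?_, ?_⟩
  · obtain ⟨e, he, -⟩ := exists_cohomologyEquiv hI hI'
      ((thetaIncl n U).toLinearMap ∘ₗ (thetaHomog n p d).subtype)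
      (hinj.comp Subtype.val_injective) (homog n U p d) (homogPred n U p d)
      (fun t => thetaIncl_mem_homog t.2) (fun t => thetaIncl_mem_thetaCompleted t.1)
      (fun a ha => by
        obtain ⟨t, ht, h⟩ := specialize_mem_map x₀ ha
        exact ⟨⟨t, ht⟩, h⟩)
      (fun a ha => homotopy_mem_homogPred ha I)
    exact ⟨e, he⟩
  · obtain ⟨e, he, hs⟩ := exists_cohomologyEquiv hI hI' (thetaIncl n U).toLinearMap hinj
      (polyPart n U) (polyPart n U) thetaIncl_mem_polyPart thetaIncl_mem_thetaCompleted
      (fun a ha => specialize_mem_range x₀ ha) (fun a ha => homotopy_mem_polyPart ha I)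
    refine ⟨e, he, fun a b ha hb => ?_⟩
    have hab := mul_mem_cocycles (fun a ha b hb => mul_mem_polyPart ha hb) ha hb
    -- After inclusion into `Â`, `e.symm` becomes the specialization, so multiplicativity follows
    -- from `specialize_mul`.
    refine ⟨hab, hinj ?_⟩
    rw [map_mul]
    refine (hs _ hab).trans ((specialize_mul x₀ a b).trans ?_)
    exact congrArg₂ (· * ·) (hs a ha).symm (hs b hb).symm
  -- Without a degree bound the specialization can be an infinite sum, so the completion itself
  -- serves as the space of representatives.
  · obtain ⟨e, he, hs⟩ := exists_cohomologyEquiv hI hI' (thetaCompleted n U).val.toLinearMap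
      Subtype.val_injective ⊤ ⊤ (fun _ => Submodule.mem_top) (fun t => t.2)
      (fun a _ => ⟨⟨_, specialize_mem_thetaCompleted x₀ a⟩, rfl⟩) (fun _ _ => Submodule.mem_top)
    refine ⟨e, he, fun a b ha hb => ?_⟩
    have hab := mul_mem_cocycles (fun _ _ _ _ => Submodule.mem_top) ha hb
    refine ⟨hab, Subtype.ext ?_⟩
    refine (hs _ hab).trans ((specialize_mul x₀ a b).trans ?_)
    exact congrArg₂ (· * ·) (hs a ha).symm (hs b hb).symm
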